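/- Let $1<p<\infty$ and let $\gamma\in\mathbb C$ satisfy $0<1/p+\Re\gamma<1$. Put $\mathbb R_+=(0,\infty)$ and $d\mu(t)=dt/t$. **Shifts.** $SO(\mathbb R_+)$ is the set of all bounded continuous $f:\mathbb R_+\to\mathbb C$ such that, for each $\lambda\in(0,1)$, $\sup_{t,\tau\in[\lambda r,r]}|f(t)-f(\tau)|\to0$ as $r\to0$ and as $r\to\infty$. $SOS(\mathbb R_+)$ is the set of all orientation-preserving diffeomorphisms $\alpha$ of $\mathbb R_+$ onto itself without fixed points in $\mathbb R_+$ such that $\log\alpha'$ is bounded and $\alpha'\in SO(\mathbb R_+)$. **Symbols.** $V(\mathbb R)$ is the set of all absolutely continuous functions $a:\mathbb R\to\mathbb C$ of finite total variation, with the norm $\|a\|_V=\|a\|_{L^\infty(\mathbb R)}+\int_{\mathbb R}|a'(x)|\,dx$. The algebra $\widetilde{\mathcal E}(\mathbb R_+,V(\mathbb R))$ consists of all bounded continuous functions $t\mapsto\mathfrak a(t,\cdot)$ from $\mathbb R_+$ to $V(\mathbb R)$ such that $$\lim_{r\to s}\ \sup_{t,\tau\in[r,2r]}\|\mathfrak a(t,\cdot)-\mathfrak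 a(\tau,\cdot)\|_{L^\infty(\mathbb R)}=0\quad(s\in\{0,\infty\}),$$ $$\lim_{|h|\to0}\ \sup_{t\in\mathbb R_+}\|\mathfrak a(t,\cdot)-\mathfrak a(t,\cdot+h)\|_V=0,\qquad \lim_{m\to\infty}\ \sup_{t\in\mathbb R_+}\int_{\mathbb R\setminus[-m,m]}|\partial_x\mathfrak a(t,x)|\,dx=0 .$$ **Operators.** Let $\Phi:L^p(\mathbb R_+)\to L^p(\mathbb R_+,d\mu)$ be the isometric isomorphism $(\Phi f)(t)=t^{1/p}f(t)$. For $\alpha\in SOS(\mathbb R_+)$ let $(U_\alpha f)(t)=(\alpha'(t))^{1/p}f(\alpha(t))$, and let $$(R_\gamma f)(t)=\frac1{\pi i}\int_{\mathbb R_+}\Big(\frac t\tau\Big)^{\gamma}\frac{f(\tau)}{\tau+t}\,d\tau .$$ For a symbol $\mathfrak a$, $\operatorname{Op}(\mathfrak a)$ denotes the bounded operator on $L^p(\mathbb R_+,d\mu)$, when there is one, that is given for $f\in C_0^\infty(\mathbb R_+)$ by the iterated integral $$[\operatorname{Op}(\mathfrak a)f](t)=\frac1{2\pi}\int_{\mathbb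 R}dx\int_{\mathbb R_+}\mathfrak a(t,x)\Big(\frac t\tau\Big)^{ix}f(\tau)\,\frac{d\tau}{\tau} .$$ **Statement.** Let $\alpha\in SOS(\mathbb R_+)$, and put $\omega(t)=\log[\alpha(t)/t]$, $r_\gamma(x)=1/\sinh[\pi(x+i/p+i\gamma)]$ and $$\mathfrak c_{\omega,\gamma}(t,x)=(1+t\omega'(t))^{1/p}e^{i\omega(t)x}r_\gamma(x),\qquad (t,x)\in\mathbb R_+\times\mathbb R .$$ Then $\mathfrak c_{\omega,\gamma}$ belongs to $\widetilde{\mathcal E}(\mathbb R_+,V(\mathbb R))$; the formulas above define an isometric isomorphism $U_\alpha$ of $L^p(\mathbb R_+)$ onto itself, a bounded operator $R_\gamma$ on $L^p(\mathbb R_+)$ (the integral converging absolutely for every $t>0$), and a unique bounded operator $\operatorname{Op}(\mathfrak c_{\omega,\gamma})$ on $L^p(\mathbb R_+,d\mu)$; and $$U_\alpha R_\gamma=\Phi^{-1}\operatorname{Op}(\mathfrak c_{\omega,\gamma})\,\Phi .$$ -/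

import Mathlib

open Set Filter Topology MeasureTheory
open scoped ENNReal

namespace MellinShift

noncomputable section

/-! ## Slowly oscillating functions and shifts on the half-line `ℝ₊ = (0, ∞)`

Functions on `ℝ₊` are functions on `ℝ` of which only the values on `Ioi 0` matter. -/

/-- `f ∈ SO(ℝ₊)`: `f` is bounded and continuous on `ℝ₊`, and for each `lam ∈ (0, 1)` the oscillation
of `f` on `[lam * r, r]` tends to `0` as `r → 0` and as `r → ∞`. Suprema are taken in `[0, ∞]`. -/
structure MemSO (f : ℝ → ℂ) : Prop where
  continuousOn : ContinuousOn f (Ioi 0)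
  bounded : ∃ C : ℝ, ∀ t > 0, ‖f t‖ ≤ C
  oscillation_zero : ∀ lam : ℝ, 0 < lam → lam < 1 →
    Tendsto (fun r : ℝ => ⨆ t ∈ Icc (lam * r) r, ⨆ τ ∈ Icc (lam * r) r, ‖f t - f τ‖ₑ)
      (𝓝[>] 0) (𝓝 0)
  oscillation_infty : ∀ lam : ℝ, 0 < lam → lam < 1 →
    Tendsto (fun r : ℝ => ⨆ t ∈ Icc (lam * r) r, ⨆ τ ∈ Icc (lam * r) r, ‖f t - f τ‖ₑ)
      atTop (𝓝 0)

/-- `α ∈ SOS(ℝ₊)`: `α` is an orientation-preserving diffeomorphism of `ℝ₊` onto itself (a bijection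
of `ℝ₊` of class `C¹` with positive derivative) without fixed points in `ℝ₊`, such that `log α'`
is bounded and `α'` is slowly oscillating. -/
structure IsSOS (α : ℝ → ℝ) : Prop where
  bijOn : BijOn α (Ioi 0) (Ioi 0)
  contDiffOn : ContDiffOn ℝ 1 α (Ioi 0)
  deriv_pos : ∀ t > 0, 0 < deriv α t
  no_fixed_point : ∀ t > 0, α t ≠ t
  log_deriv_bounded : ∃ C : ℝ, ∀ t > 0, |Real.log (deriv α t)| ≤ C
  deriv_memSO : MemSO (fun t => Complex.ofReal (deriv α t))

/-! ## The algebra `V(ℝ)` and algebras of `V(ℝ)`-valued symbols -/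

/-- `a ∈ V(ℝ)`: `a` is absolutely continuous (on every compact interval) and has finite total
variation `∫ |a'|`. -/
structure MemV (a : ℝ → ℂ) : Prop where
  absolutelyContinuous : ∀ u v : ℝ, AbsolutelyContinuousOnInterval a u v
  integrable_deriv : Integrable (deriv a)

/-- The norm `‖a‖_V = ‖a‖_{L^∞} + ∫ |a'|` of `a ∈ V(ℝ)`, with values in `[0, ∞]`. -/
def vNorm (a : ℝ → ℂ) : ℝ≥0∞ :=
  eLpNorm a ∞ volume + ∫⁻ x, ‖deriv a x‖ₑ

/-- `a ∈ C_b(ℝ₊, V(ℝ))`: a bounded continuous function on `ℝ₊` with values in `V(ℝ)`. -/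
structure MemCbV (a : ℝ → ℝ → ℂ) : Prop where
  memV : ∀ t > 0, MemV (a t)
  bounded : (⨆ t ∈ Ioi (0 : ℝ), vNorm (a t)) < ∞
  continuous : ∀ t > 0, Tendsto (fun τ => vNorm (a τ - a t)) (𝓝 t) (𝓝 0)

/-- `a ∈ SO(ℝ₊, V(ℝ))`: slow oscillation at `0` and `∞` with respect to the `L^∞(ℝ)` norm. -/
structure MemSOV (a : ℝ → ℝ → ℂ) : Prop extends MemCbV a where
  oscillation_zero :
    Tendsto (fun r : ℝ => ⨆ t ∈ Icc r (2 * r), ⨆ τ ∈ Icc r (2 * r), eLpNorm (a t - a τ) ∞ volume)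
      (𝓝[>] 0) (𝓝 0)
  oscillation_infty :
    Tendsto (fun r : ℝ => ⨆ t ∈ Icc r (2 * r), ⨆ τ ∈ Icc r (2 * r), eLpNorm (a t - a τ) ∞ volume)
      atTop (𝓝 0)

/-- `a ∈ 𝓔(ℝ₊, V(ℝ))`: translations in the second variable are continuous in the norm of `V(ℝ)`,
uniformly in the first variable. -/
structure MemE (a : ℝ → ℝ → ℂ) : Prop extends MemSOV a where
  translation :
    Tendsto (fun h : ℝ => ⨆ t ∈ Ioi (0 : ℝ), vNorm (fun x => a t x - a t (x + h))) (𝓝 0) (𝓝 0)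

/-- `a ∈ 𝓔~(ℝ₊, V(ℝ))`: in addition, the variation of `a(t, ·)` off `[-m, m]` tends to `0` as
`m → ∞`, uniformly in `t`. -/
structure MemETilde (a : ℝ → ℝ → ℂ) : Prop extends MemE a where
  tail :
    Tendsto (fun m : ℝ => ⨆ t ∈ Ioi (0 : ℝ), ∫⁻ x in (Icc (-m) m)ᶜ, ‖deriv (a t) x‖ₑ)
      atTop (𝓝 0)

/-! ## The Lebesgue spaces `L^p(ℝ₊)` and `L^p(ℝ₊, dμ)` -/

/-- Lebesgue measure on `ℝ₊`. -/
def volPlus : Measure ℝ := volume.restrict (Ioi 0)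

/-- The invariant measure `dμ(t) = dt/t` on `ℝ₊`. -/
def mu : Measure ℝ := volPlus.withDensity fun t => ENNReal.ofReal (1 / t)

instance fact_one_le_ofReal (p : ℝ) [hp : Fact (1 < p)] : Fact (1 ≤ ENNReal.ofReal p) :=
  ⟨ENNReal.one_le_ofReal.2 hp.out.le⟩

/-- `L^p(ℝ₊)`. -/
abbrev LpPlus (p : ℝ) : Type := Lp ℂ (ENNReal.ofReal p) volPlus

/-- `L^p(ℝ₊, dμ)`. -/
abbrev LpMu (p : ℝ) : Type := Lp ℂ (ENNReal.ofReal p) mu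

theorem ae_pos : ∀ᵐ t ∂volPlus, (0 : ℝ) < t :=
  ae_restrict_mem measurableSet_Ioi

theorem measurable_density : Measurable fun t : ℝ => ENNReal.ofReal (1 / t) := by
  fun_prop

theorem mu_ac : mu ≪ volPlus := withDensity_absolutelyContinuous _ _

theorem ac_mu : volPlus ≪ mu := by
  refine withDensity_absolutelyContinuous' measurable_density.aemeasurable ?_
  filter_upwards [ae_pos] with t ht
  have : 0 < 1 / t := by positivity
  simpa using ht

/-- Multiplication by `t ^ (1 / p)`, the formula for `Φ`. -/
def phiFun (p : ℝ) (f : ℝ → ℂ) (t : ℝ) : ℂ := ((t ^ (1 / p) : ℝ) : ℂ) * f t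

/-- Multiplication by `t ^ (-1 / p)`, the formula for the inverse of `Φ`. -/
def phiInvFun (p : ℝ) (f : ℝ → ℂ) (t : ℝ) : ℂ := ((t ^ (-(1 / p)) : ℝ) : ℂ) * f t

theorem phi_phiInv (p : ℝ) (f : ℝ → ℂ) {t : ℝ} (ht : 0 < t) :
    phiFun p (phiInvFun p f) t = f t := by
  unfold phiFun phiInvFun
  rw [← mul_assoc, ← Complex.ofReal_mul, ← Real.rpow_add ht]
  simp

theorem phiInv_phi (p : ℝ) (f : ℝ → ℂ) {t : ℝ} (ht : 0 < t) :
    phiInvFun p (phiFun p f) t = f t := by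
  unfold phiFun phiInvFun
  rw [← mul_assoc, ← Complex.ofReal_mul, ← Real.rpow_add ht]
  simp

theorem eLpNorm_phiFun (p : ℝ) [hp : Fact (1 < p)] (f : ℝ → ℂ) :
    eLpNorm (phiFun p f) (ENNReal.ofReal p) mu = eLpNorm f (ENNReal.ofReal p) volPlus := by
  have hp0 : 0 < p := lt_trans one_pos hp.out
  have h0 : ENNReal.ofReal p ≠ 0 := by simpa using hp0
  rw [eLpNorm_eq_lintegral_rpow_enorm_toReal h0 ENNReal.ofReal_ne_top,
    eLpNorm_eq_lintegral_rpow_enorm_toReal h0 ENNReal.ofReal_ne_top,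
    ENNReal.toReal_ofReal hp0.le, mu,
    lintegral_withDensity_eq_lintegral_mul_non_measurable _ measurable_density
      (Eventually.of_forall fun _ => ENNReal.ofReal_lt_top)]
  congr 1
  refine lintegral_congr_ae ?_
  filter_upwards [ae_pos] with t ht
  have h1 : (0 : ℝ) < t ^ (1 / p) := Real.rpow_pos_of_pos ht _
  have h2 : ‖phiFun p f t‖ₑ ^ p = ENNReal.ofReal t * ‖f t‖ₑ ^ p := by
    unfold phiFun
    rw [enorm_mul, ENNReal.mul_rpow_of_nonneg _ _ hp0.le]
    congr 1
    rw [← ofReal_norm, Complex.norm_real, Real.norm_of_nonneg h1.le,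
      ENNReal.ofReal_rpow_of_pos h1, ← Real.rpow_mul ht.le]
    congr 1
    rw [one_div, inv_mul_cancel₀ hp0.ne', Real.rpow_one]
  rw [Pi.mul_apply, h2, ← mul_assoc, ← ENNReal.ofReal_mul (by positivity)]
  rw [one_div, inv_mul_cancel₀ ht.ne']
  simp

theorem memLp_phiFun (p : ℝ) [Fact (1 < p)] (f : LpPlus p) :
    MemLp (phiFun p f) (ENNReal.ofReal p) mu := by
  refine ⟨?_, ?_⟩
  · have h : Measurable fun t : ℝ => ((t ^ (1 / p) : ℝ) : ℂ) := by fun_prop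
    exact h.aestronglyMeasurable.mul ((Lp.aestronglyMeasurable f).mono_ac mu_ac)
  · rw [eLpNorm_phiFun]
    exact Lp.eLpNorm_lt_top f

theorem memLp_phiInvFun (p : ℝ) [Fact (1 < p)] (f : LpMu p) :
    MemLp (phiInvFun p f) (ENNReal.ofReal p) volPlus := by
  refine ⟨?_, ?_⟩
  · have h : Measurable fun t : ℝ => ((t ^ (-(1 / p)) : ℝ) : ℂ) := by fun_prop
    exact h.aestronglyMeasurable.mul ((Lp.aestronglyMeasurable f).mono_ac ac_mu)
  · have h : phiFun p (phiInvFun p f) =ᵐ[mu] f := by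
      filter_upwards [mu_ac.ae_le ae_pos] with t ht using phi_phiInv p f ht
    rw [← eLpNorm_phiFun, eLpNorm_congr_ae h]
    exact Lp.eLpNorm_lt_top f

/-- The isometric isomorphism `Φ : L^p(ℝ₊) → L^p(ℝ₊, dμ)`, `(Φ f)(t) = t ^ (1 / p) * f t`. -/
def Phi (p : ℝ) [Fact (1 < p)] : LpPlus p ≃ₗᵢ[ℂ] LpMu p where
  toFun f := (memLp_phiFun p f).toLp _
  invFun g := (memLp_phiInvFun p g).toLp _
  map_add' f g := by
    apply Lp.ext
    filter_upwards [(memLp_phiFun p (f + g)).coeFn_toLp, (memLp_phiFun p f).coeFn_toLp,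
      (memLp_phiFun p g).coeFn_toLp, Lp.coeFn_add ((memLp_phiFun p f).toLp _)
      ((memLp_phiFun p g).toLp _), mu_ac.ae_le (Lp.coeFn_add f g)] with t h1 h2 h3 h4 h5
    rw [h1, h4, Pi.add_apply, h2, h3]
    simp only [phiFun]
    rw [h5, Pi.add_apply, mul_add]
  map_smul' c f := by
    apply Lp.ext
    filter_upwards [(memLp_phiFun p (c • f)).coeFn_toLp, (memLp_phiFun p f).coeFn_toLp,
      Lp.coeFn_smul c ((memLp_phiFun p f).toLp _),
      mu_ac.ae_le (Lp.coeFn_smul c f)] with t h1 h2 h4 h5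
    rw [h1, RingHom.id_apply, h4, Pi.smul_apply, h2]
    simp only [phiFun]
    rw [h5, Pi.smul_apply, smul_eq_mul, smul_eq_mul]
    ring
  left_inv f := by
    apply Lp.ext
    filter_upwards [(memLp_phiInvFun p ((memLp_phiFun p f).toLp _)).coeFn_toLp,
      ac_mu.ae_le (memLp_phiFun p f).coeFn_toLp, ae_pos] with t h1 h2 ht
    rw [h1, ← phiInv_phi p f ht, phiInvFun, h2, phiInvFun]
  right_inv g := by
    apply Lp.ext
    filter_upwards [(memLp_phiFun p ((memLp_phiInvFun p g).toLp _)).coeFn_toLp,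
      mu_ac.ae_le (memLp_phiInvFun p g).coeFn_toLp, mu_ac.ae_le ae_pos] with t h1 h2 ht
    rw [h1, ← phi_phiInv p g ht, phiFun, h2, phiFun]
  norm_map' f := by
    change ‖(memLp_phiFun p f).toLp _‖ = ‖f‖
    rw [Lp.norm_toLp, eLpNorm_phiFun, Lp.norm_def]

/-! ## The operators -/

/-- The weighted shift `(U_α f)(t) = (α'(t)) ^ (1 / p) * f (α t)`. -/
def weightedShift (p : ℝ) (α : ℝ → ℝ) (f : ℝ → ℂ) (t : ℝ) : ℂ :=
  ((deriv α t ^ (1 / p) : ℝ) : ℂ) * f (α t)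

/-- `U` is the operator `U_α` on `L^p(ℝ₊)`. -/
def IsWeightedShift (p : ℝ) [Fact (1 < p)] (α : ℝ → ℝ) (U : LpPlus p ≃ₗᵢ[ℂ] LpPlus p) : Prop :=
  ∀ f : LpPlus p, U f =ᵐ[volPlus] weightedShift p α f

/-- The integrand `(t / τ) ^ γ * f τ / (τ + t)` of the operator `R_γ`. -/
def rIntegrand (γ : ℂ) (f : ℝ → ℂ) (t τ : ℝ) : ℂ :=
  ((t / τ : ℝ) : ℂ) ^ γ * f τ / ((τ + t : ℝ) : ℂ)

/-- `R` is the operator `R_γ` on `L^p(ℝ₊)`: for each `f`, the integral converges absolutely for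
all `t > 0`, and `(R f)(t) = (1 / (π i)) ∫ (t / τ) ^ γ * f τ / (τ + t) dτ` for almost all `t`. -/
def IsROperator (p : ℝ) [Fact (1 < p)] (γ : ℂ) (R : LpPlus p →L[ℂ] LpPlus p) : Prop :=
  ∀ f : LpPlus p,
    (∀ t > 0, IntegrableOn (rIntegrand γ f t) (Ioi 0)) ∧
    R f =ᵐ[volPlus] fun t =>
      1 / (Real.pi * Complex.I) * ∫ τ in Ioi (0 : ℝ), rIntegrand γ f t τ

/-- `f ∈ C_0^∞(ℝ₊)`. -/
structure IsTestFunction (f : ℝ → ℂ) : Prop where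
  smooth : ContDiff ℝ (⊤ : ℕ∞) f
  compact : HasCompactSupport f
  support : tsupport f ⊆ Ioi 0

theorem mu_lt_top_of_isCompact {K : Set ℝ} (hK : IsCompact K) (h : K ⊆ Ioi 0) : mu K < ∞ := by
  rcases K.eq_empty_or_nonempty with rfl | hne
  · simp
  obtain ⟨a, haK, ha⟩ := hK.exists_isLeast hne
  have ha0 : 0 < a := h haK
  rw [mu, withDensity_apply _ hK.measurableSet]
  calc ∫⁻ t in K, ENNReal.ofReal (1 / t) ∂volPlus
      ≤ ∫⁻ _ in K, ENNReal.ofReal (1 / a) ∂volPlus := by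
        refine setLIntegral_mono' hK.measurableSet fun t ht => ?_
        exact ENNReal.ofReal_le_ofReal (one_div_le_one_div_of_le ha0 (ha ht))
    _ = ENNReal.ofReal (1 / a) * volPlus K := by simp
    _ < ∞ := by
        refine ENNReal.mul_lt_top ENNReal.ofReal_lt_top ?_
        exact lt_of_le_of_lt (Measure.restrict_apply_le _ _) hK.measure_lt_top

/-- Test functions belong to `L^p(ℝ₊, dμ)`. -/
theorem IsTestFunction.memLp {f : ℝ → ℂ} (hf : IsTestFunction f) (q : ℝ≥0∞) : MemLp f q mu := by
  have hK : IsCompact (tsupport f) := hf.compact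
  have hc : Continuous f := hf.smooth.continuous
  obtain ⟨C, hC⟩ := hc.bounded_above_of_compact_support hf.compact
  have hfin : IsFiniteMeasure (mu.restrict (tsupport f)) :=
    ⟨by simpa using mu_lt_top_of_isCompact hK hf.support⟩
  have h : MemLp f q (mu.restrict (tsupport f)) :=
    MemLp.of_bound hc.aestronglyMeasurable C (Eventually.of_forall hC)
  have h2 := (memLp_indicator_iff_restrict (f := f) (p := q) (μ := mu)
    hK.measurableSet).2 h
  rwa [indicator_eq_self.2 (subset_tsupport f)] at h2

/-- The integrand `a(t, x) * (t / τ) ^ (i x) * f τ / τ` of a Mellin pseudodifferential operator. -/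
def opIntegrand (a : ℝ → ℝ → ℂ) (f : ℝ → ℂ) (t x τ : ℝ) : ℂ :=
  a t x * ((t / τ : ℝ) : ℂ) ^ (Complex.I * x) * f τ / (τ : ℂ)

/-- `A` is the Mellin pseudodifferential operator `Op(a)` on `L^p(ℝ₊, dμ)`, that is, a bounded
operator which on `C_0^∞(ℝ₊)` is given by the convergent iterated integral
`(Op(a) f)(t) = (1 / (2 π)) ∫_ℝ dx ∫_{ℝ₊} a(t, x) * (t / τ) ^ (i x) * f τ dτ / τ`. -/
def IsMellinPDO (p : ℝ) [Fact (1 < p)] (a : ℝ → ℝ → ℂ) (A : LpMu p →L[ℂ] LpMu p) : Prop :=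
  ∀ (f : ℝ → ℂ) (hf : IsTestFunction f),
    (∀ t > 0, ∀ x : ℝ, IntegrableOn (opIntegrand a f t x) (Ioi 0)) ∧
    (∀ t > 0, Integrable fun x : ℝ => ∫ τ in Ioi (0 : ℝ), opIntegrand a f t x τ) ∧
    A ((hf.memLp _).toLp f) =ᵐ[mu] fun t =>
      1 / (2 * Real.pi) * ∫ x : ℝ, ∫ τ in Ioi (0 : ℝ), opIntegrand a f t x τ

/-! ## The symbol -/

/-- `r_γ(x) = 1 / sinh(π (x + i / p + i γ))`. -/
def rSymbol (p : ℝ) (γ : ℂ) (x : ℝ) : ℂ :=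
  1 / Complex.sinh (Real.pi * (x + Complex.I / p + Complex.I * γ))

/-- `ω(t) = log (α(t) / t)`. -/
def shiftExponent (α : ℝ → ℝ) (t : ℝ) : ℝ := Real.log (α t / t)

/-- `c_{ω,γ}(t, x) = (1 + t ω'(t)) ^ (1 / p) * exp(i ω(t) x) * r_γ(x)`. -/
def cSymbol (p : ℝ) (γ : ℂ) (ω : ℝ → ℝ) (t x : ℝ) : ℂ :=
  (((1 + t * deriv ω t) ^ (1 / p) : ℝ) : ℂ) * Complex.exp (Complex.I * ω t * x) * rSymbol p γ x

end

end MellinShift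

namespace MellinShift

/-! ### Exponential bounds for the symbol `r_γ` -/

/-! Put δ = 1/p + γ and κ(s) = s^δ / (1 + s). Conjugation by `Phi` turns `R_γ` into the
multiplicative convolution with kernel κ(t/τ)/(πi) with respect to dτ/τ (`rIntegrand_eq`). Since 0 <
Re δ < 1, κ is integrable for this invariant measure, and the Schur test bounds the operator on
every `L^p(ℝ₊, dμ)`.

The Mellin transform of 1/(1 + t) is π / sin(πs), by the Beta integral and the reflection formula.
Mellin inversion on the line Re s = Re δ therefore exhibits κ(s)/(πi) as (1/2π) ∫ s^{ix} r_γ(x) dx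
(`integral_cpow_mul_rSymbol`), so the convolution is the Mellin pseudodifferential operator with
symbol r_γ. Applying `U_α` replaces t by α(t). The identity (α(t)/τ)^{ix} = e^{iω(t)x} (t/τ)^{ix}
produces the exponential in the symbol, and the powers of t, α(t) and α'(t) combine to (1 +
tω'(t))^{1/p}, because 1 + tω'(t) = tα'(t)/α(t). Hence the conjugate of `U_α R_γ` is given by the
required iterated integral on test functions (`isMellinPDO_conj`); their density makes the bounded
extension unique.

Membership in the symbol algebra separates x from t. The function r_γ and its first two derivatives
decay exponentially, so ψ e^{iωx} r_γ(x) depends on the real parameters ψ, ω in a locally Lipschitz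
way in the norm of V(ℝ), and its translation and tail moduli are uniform for bounded ψ, ω
(`memETilde_model`). It remains to see that ψ(t) and ω(t) are bounded, continuous and slowly
oscillating. This rests on α(t)/t − α'(t) → 0 at both ends (`tendsto_div_sub_deriv`), a consequence
of the mean value theorem and the slow oscillation of α'. -/

theorem sin_mul_cosh_le_norm_sinh (z : ℂ) : Real.cosh z.re * Real.sin z.im ≤ ‖Complex.sinh z‖ := by
  have h : (Complex.sinh z).im = Real.cosh z.re * Real.sin z.im := by
    conv_lhs => rw [← Complex.re_add_im z]
    rw [Complex.sinh_add, Complex.sinh_mul_I, Complex.cosh_mul_I, ← Complex.ofReal_sinh,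
      ← Complex.ofReal_cosh, ← Complex.ofReal_sin, ← Complex.ofReal_cos]
    simp only [Complex.add_im, Complex.mul_im, Complex.mul_re, Complex.ofReal_re, Complex.ofReal_im,
      Complex.I_re, Complex.I_im]
    ring
  rw [← h]
  exact (le_abs_self _).trans (Complex.abs_im_le_norm _)

theorem norm_cosh_le (z : ℂ) : ‖Complex.cosh z‖ ≤ Real.cosh z.re := by
  rw [Complex.cosh, Real.cosh_eq, norm_div, Complex.norm_two]
  gcongr
  refine (norm_add_le _ _).trans ?_
  rw [Complex.norm_exp, Complex.norm_exp, Complex.neg_re]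

/-- Half of the decay pays for one factor x. Such a factor arises from differences of e^{iωx} in ω,
which is why symbols are bounded by exp(-2|x|) and `V`-norms estimated with exp(-|x|). -/
theorem mul_exp_neg_two_mul_le (x : ℝ) : x * Real.exp (-(2 * x)) ≤ Real.exp (-x) := by
  have h : Real.exp (-(2 * x)) = Real.exp (-x) * Real.exp (-x) := by
    rw [← Real.exp_add]; ring_nf
  have h1 : x * Real.exp (-x) ≤ 1 := by
    have h2 : Real.exp (-x) * Real.exp x = 1 := by rw [← Real.exp_add]; simp
    have h3 := Real.add_one_le_exp x
    have := Real.exp_pos (-x)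
    nlinarith
  rw [h, ← mul_assoc]
  exact mul_le_of_le_one_left (Real.exp_pos _).le h1

/-- `r` and its derivatives `r₁`, `r₂` decay exponentially. -/
structure IsRapidSymbol (r r₁ r₂ : ℝ → ℂ) (K : ℝ) : Prop where
  nonneg : 0 ≤ K
  hasDerivAt : ∀ x, HasDerivAt r (r₁ x) x
  hasDerivAt₁ : ∀ x, HasDerivAt r₁ (r₂ x) x
  bound : ∀ x, ‖r x‖ ≤ K * Real.exp (-(2 * |x|))
  bound₁ : ∀ x, ‖r₁ x‖ ≤ K * Real.exp (-(2 * |x|))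
  bound₂ : ∀ x, ‖r₂ x‖ ≤ K * Real.exp (-(2 * |x|))

theorem rSymbol_arg (p : ℝ) (γ : ℂ) (x : ℝ) :
    (Real.pi * (x + Complex.I / p + Complex.I * γ) : ℂ).re = Real.pi * (x - γ.im) ∧
    (Real.pi * (x + Complex.I / p + Complex.I * γ) : ℂ).im = Real.pi * (1 / p + γ.re) := by
  have h : Complex.I / (p : ℂ) = ((1 / p : ℝ) : ℂ) * Complex.I := by push_cast; ring
  rw [h]
  constructor <;> simp [sub_eq_add_neg]

theorem sin_pi_mul_pos {θ : ℝ} (h0 : 0 < θ) (h1 : θ < 1) : 0 < Real.sin (Real.pi * θ) :=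
  Real.sin_pos_of_pos_of_lt_pi (by positivity) (by nlinarith [Real.pi_pos])

/-- The argument z of sinh has constant imaginary part in (0, π), so |sinh z| ≥ s cosh(Re z) with s
> 0. Thus 1/sinh z decays at rate π, of which only the rate 2 is kept, and cosh z / sinh z is
bounded by 1/s. The derivatives of r_γ are 1/sinh z times polynomials in this quotient. -/
theorem exists_isRapidSymbol_rSymbol {p : ℝ} {γ : ℂ}
    (hγ0 : 0 < 1 / p + γ.re) (hγ1 : 1 / p + γ.re < 1) :
    ∃ r₁ r₂ K, IsRapidSymbol (rSymbol p γ) r₁ r₂ K := by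
  set z : ℝ → ℂ := fun x => Real.pi * (x + Complex.I / p + Complex.I * γ) with hz
  set s : ℝ := Real.sin (Real.pi * (1 / p + γ.re)) with hs
  have hs0 : 0 < s := sin_pi_mul_pos hγ0 hγ1
  have hlow (x) : Real.cosh (Real.pi * (x - γ.im)) * s ≤ ‖Complex.sinh (z x)‖ := by
    have := sin_mul_cosh_le_norm_sinh (z x)
    rwa [(rSymbol_arg p γ x).1, (rSymbol_arg p γ x).2] at this
  have hup (x) : ‖Complex.cosh (z x)‖ ≤ Real.cosh (Real.pi * (x - γ.im)) := by
    have := norm_cosh_le (z x)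
    rwa [(rSymbol_arg p γ x).1] at this
  have hpos (x) : 0 < ‖Complex.sinh (z x)‖ :=
    lt_of_lt_of_le (mul_pos (Real.cosh_pos _) hs0) (hlow x)
  have hne (x) : Complex.sinh (z x) ≠ 0 := norm_pos_iff.1 (hpos x)
  have hzd (x) : HasDerivAt z Real.pi x := by
    have : HasDerivAt (fun x : ℝ => (x : ℂ)) 1 x := Complex.ofRealCLM.hasDerivAt
    simpa using! ((this.add_const (Complex.I / p)).add_const (Complex.I * γ)).const_mul
      (Real.pi : ℂ)
  have hS (x) : HasDerivAt (fun x => Complex.sinh (z x)) (Complex.cosh (z x) * Real.pi) x :=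
    (Complex.hasDerivAt_sinh (z x)).comp x (hzd x)
  have hC (x) : HasDerivAt (fun x => Complex.cosh (z x)) (Complex.sinh (z x) * Real.pi) x :=
    (Complex.hasDerivAt_cosh (z x)).comp x (hzd x)
  have hinv (x) : ‖Complex.sinh (z x)‖⁻¹ ≤
      2 / s * Real.exp (Real.pi * |γ.im|) * Real.exp (-(2 * |x|)) := by
    have h1 : Real.exp (2 * |x| - Real.pi * |γ.im|) / 2 * s ≤ ‖Complex.sinh (z x)‖ := by
      refine le_trans ?_ (hlow x)
      gcongr
      have h2 : Real.exp |Real.pi * (x - γ.im)| / 2 ≤ Real.cosh (Real.pi * (x - γ.im)) := by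
        rw [← Real.cosh_abs, Real.cosh_eq]
        gcongr
        linarith [Real.exp_pos (-|Real.pi * (x - γ.im)|)]
      refine le_trans ?_ h2
      gcongr
      rw [abs_mul, abs_of_pos Real.pi_pos]
      have h3 := abs_sub_abs_le_abs_sub x γ.im
      have h4 := Real.pi_gt_three
      nlinarith [abs_nonneg x, abs_nonneg γ.im]
    calc ‖Complex.sinh (z x)‖⁻¹ ≤ (Real.exp (2 * |x| - Real.pi * |γ.im|) / 2 * s)⁻¹ := by
          gcongr
      _ = _ := by
          rw [sub_eq_add_neg, Real.exp_add, Real.exp_neg, Real.exp_neg (2 * |x|)]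
          field_simp
  have hquot (x) : ‖Complex.cosh (z x)‖ * ‖Complex.sinh (z x)‖⁻¹ ≤ s⁻¹ := by
    rw [← div_eq_mul_inv, div_le_iff₀ (hpos x), inv_mul_eq_div, le_div_iff₀ hs0]
    exact (mul_le_mul_of_nonneg_right (hup x) hs0.le).trans (hlow x)
  set B : ℝ := 2 / s * Real.exp (Real.pi * |γ.im|) with hB
  have hB0 : 0 ≤ B := by positivity
  have hπ := Real.pi_pos
  have hs1 : s ≤ 1 := Real.sin_le_one _
  have hsi : 1 ≤ s⁻¹ := (one_le_inv₀ hs0).2 hs1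
  have hπ1 : 1 ≤ Real.pi := by linarith [Real.pi_gt_three]
  -- `L` is the factor needed for the second derivative; it also dominates 1 and π/s, the factors
  -- for r and r', so `L * B` serves all three bounds.
  set L : ℝ := Real.pi ^ 2 * (2 * s⁻¹ ^ 2 + 1) with hL
  have hL1 : 1 ≤ L := by
    have : 1 ≤ Real.pi ^ 2 := one_le_pow₀ hπ1
    have : 1 ≤ 2 * s⁻¹ ^ 2 + 1 := by linarith [sq_nonneg s⁻¹]
    nlinarith
  have hL2 : Real.pi * s⁻¹ ≤ L := by
    have : Real.pi * 1 ≤ Real.pi * Real.pi := by gcongr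
    have h2 : s⁻¹ ≤ 2 * s⁻¹ ^ 2 + 1 := by nlinarith
    calc Real.pi * s⁻¹ ≤ Real.pi ^ 2 * (2 * s⁻¹ ^ 2 + 1) := by
          gcongr
          nlinarith
      _ = L := rfl
  refine ⟨fun x => -(Complex.cosh (z x) * Real.pi) / Complex.sinh (z x) ^ 2,
    fun x => Real.pi ^ 2 * (2 * Complex.cosh (z x) ^ 2 / Complex.sinh (z x) ^ 3
      - 1 / Complex.sinh (z x)), L * B, by positivity, fun x => ?_, fun x => ?_, fun x => ?_,
      fun x => ?_, fun x => ?_⟩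
  · have := (hS x).fun_inv (hne x)
    have h2 : rSymbol p γ = fun i => (Complex.sinh (z i))⁻¹ := funext fun y => by
      rw [rSymbol, one_div]
    rwa [h2]
  · have h1 := ((hC x).mul_const (Real.pi : ℂ)).fun_neg.fun_div ((hS x).fun_pow 2)
      (pow_ne_zero 2 (hne x))
    refine h1.congr_deriv ?_
    have := hne x
    field_simp
    ring
  · rw [rSymbol, norm_div, norm_one, one_div, mul_assoc]
    have := hinv x
    have h0 : 0 ≤ B * Real.exp (-(2 * |x|)) := by positivity
    nlinarith
  · rw [norm_div, norm_neg, norm_mul, norm_pow, Complex.norm_real, Real.norm_of_nonneg hπ.le]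
    calc ‖Complex.cosh (z x)‖ * Real.pi / ‖Complex.sinh (z x)‖ ^ 2
        = Real.pi * (‖Complex.cosh (z x)‖ * ‖Complex.sinh (z x)‖⁻¹) * ‖Complex.sinh (z x)‖⁻¹ := by
          have := (hpos x).ne'
          field_simp
      _ ≤ Real.pi * s⁻¹ * (B * Real.exp (-(2 * |x|))) := by
          gcongr
          · exact hquot x
          · exact hinv x
      _ ≤ L * (B * Real.exp (-(2 * |x|))) := by gcongr
      _ = _ := by ring
  · rw [norm_mul, norm_pow, Complex.norm_real, Real.norm_of_nonneg hπ.le]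
    calc Real.pi ^ 2 * ‖2 * Complex.cosh (z x) ^ 2 / Complex.sinh (z x) ^ 3
          - 1 / Complex.sinh (z x)‖
        ≤ Real.pi ^ 2 * (‖2 * Complex.cosh (z x) ^ 2 / Complex.sinh (z x) ^ 3‖
          + ‖1 / Complex.sinh (z x)‖) := by
          gcongr
          exact norm_sub_le _ _
      _ = Real.pi ^ 2 * (2 * (‖Complex.cosh (z x)‖ * ‖Complex.sinh (z x)‖⁻¹) ^ 2 + 1)
          * ‖Complex.sinh (z x)‖⁻¹ := by
          have := (hpos x).ne'
          simp only [norm_div, norm_mul, norm_pow, Complex.norm_two, norm_one]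
          field_simp
      _ ≤ Real.pi ^ 2 * (2 * s⁻¹ ^ 2 + 1) * (B * Real.exp (-(2 * |x|))) := by
          gcongr
          · exact hquot x
          · exact hinv x
      _ = _ := by ring

/-! ### Estimates in `V(ℝ)` -/

theorem integrable_exp_neg_abs : Integrable fun x : ℝ => Real.exp (-|x|) := by
  rw [← integrableOn_univ, ← Iic_union_Ioi (a := (0 : ℝ)), integrableOn_union]
  refine ⟨(integrableOn_exp_Iic 0).congr_fun (fun x hx => ?_) measurableSet_Iic,
    (integrableOn_exp_neg_Ioi 0).congr_fun (fun x hx => ?_) measurableSet_Ioi⟩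
  · simp [abs_of_nonpos (mem_Iic.1 hx)]
  · simp [abs_of_pos (mem_Ioi.1 hx)]

/-- A constant bounding `vNorm` in terms of exponential bounds. -/
noncomputable def expMass : ℝ := 1 + ∫ x : ℝ, Real.exp (-|x|)

theorem expMass_pos : 0 < expMass :=
  add_pos_of_pos_of_nonneg one_pos (integral_nonneg fun _ => (Real.exp_pos _).le)

theorem lintegral_enorm_le_of_norm_le {f : ℝ → ℂ} {A : ℝ} (s : Set ℝ) (hs : MeasurableSet s)
    (hA : 0 ≤ A) (hf : ∀ x ∈ s, ‖f x‖ ≤ A * Real.exp (-|x|)) :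
    ∫⁻ x in s, ‖f x‖ₑ ≤ ENNReal.ofReal (A * ∫ x : ℝ, Real.exp (-|x|)) := by
  have hi := integrable_exp_neg_abs.const_mul A
  rw [← integral_const_mul, ofReal_integral_eq_lintegral_ofReal hi
    (Eventually.of_forall fun x => by positivity)]
  refine le_trans (setLIntegral_mono' hs fun x hx => ?_) (setLIntegral_le_lintegral s _)
  rw [← ofReal_norm]
  exact ENNReal.ofReal_le_ofReal (hf x hx)

theorem vNorm_le {f f' : ℝ → ℂ} {A : ℝ} (hA : 0 ≤ A) (hd : ∀ x, HasDerivAt f (f' x) x)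
    (hf : ∀ x, ‖f x‖ ≤ A * Real.exp (-|x|)) (hf' : ∀ x, ‖f' x‖ ≤ A * Real.exp (-|x|)) :
    vNorm f ≤ ENNReal.ofReal (A * expMass) := by
  have hdf : deriv f = f' := funext fun x => (hd x).deriv
  rw [vNorm, hdf, expMass, mul_add, ENNReal.ofReal_add (by simpa using hA)
    (mul_nonneg hA (integral_nonneg fun _ => (Real.exp_pos _).le)), mul_one]
  gcongr
  · rw [eLpNorm_exponent_top, eLpNormEssSup]
    refine essSup_le_of_ae_le _ (Eventually.of_forall fun x => ?_)
    change ‖f x‖ₑ ≤ _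
    rw [← ofReal_norm]
    refine ENNReal.ofReal_le_ofReal ((hf x).trans (mul_le_of_le_one_right hA ?_))
    simp
  · simpa using lintegral_enorm_le_of_norm_le univ MeasurableSet.univ hA fun x _ => hf' x

theorem eLpNorm_top_le_vNorm (f : ℝ → ℂ) : eLpNorm f ∞ volume ≤ vNorm f := le_self_add

/-- A function whose derivative decays exponentially varies little under small translations. -/
theorem norm_sub_translate_le {G G' : ℝ → ℂ} {D : ℝ} (hD : 0 ≤ D)
    (hd : ∀ x, HasDerivAt G (G' x) x) (hG' : ∀ x, ‖G' x‖ ≤ D * Real.exp (-|x|))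
    {h : ℝ} (hh : |h| ≤ 1) (x : ℝ) :
    ‖G x - G (x + h)‖ ≤ D * Real.exp 1 * |h| * Real.exp (-|x|) := by
  have hb : ∀ y ∈ uIcc x (x + h), ‖G' y‖ ≤ D * Real.exp 1 * Real.exp (-|x|) := by
    intro y hy
    refine (hG' y).trans ?_
    rw [mul_assoc, ← Real.exp_add]
    gcongr
    have h1 : |y - x| ≤ |h| := by simpa using abs_sub_left_of_mem_uIcc hy
    have h2 := abs_sub_abs_le_abs_sub x y
    rw [abs_sub_comm] at h2
    linarith
  have := Convex.norm_image_sub_le_of_norm_hasDerivWithin_le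
    (fun y _ => (hd y).hasDerivWithinAt) hb (convex_uIcc x (x + h)) right_mem_uIcc left_mem_uIcc
  refine this.trans (le_of_eq ?_)
  simp
  ring

/-! ### The model symbol -/

/-- The function `ψ * exp(i ω x) * r(x)`. -/
noncomputable def model (r : ℝ → ℂ) (ψ ω x : ℝ) : ℂ := ψ * Complex.exp (Complex.I * ω * x) * r x

/-- The derivative of `model r ψ ω`. -/
noncomputable def modelDeriv (r r₁ : ℝ → ℂ) (ψ ω x : ℝ) : ℂ :=
  ψ * Complex.exp (Complex.I * ω * x) * (Complex.I * ω * r x + r₁ x)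

theorem norm_exp_I_mul (ω x : ℝ) : ‖Complex.exp (Complex.I * ω * x)‖ = 1 := by
  rw [Complex.norm_exp]; simp

theorem hasDerivAt_exp_I_mul (ω x : ℝ) :
    HasDerivAt (fun x : ℝ => Complex.exp (Complex.I * ω * x))
      (Complex.exp (Complex.I * ω * x) * (Complex.I * ω)) x := by
  have h : HasDerivAt (fun x : ℝ => Complex.I * ω * (x : ℂ)) (Complex.I * ω) x := by
    simpa using (Complex.ofRealCLM.hasDerivAt (x := x)).const_mul (Complex.I * (ω : ℂ))
  exact (Complex.hasDerivAt_exp _).comp x h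

/-- Stated for an arbitrary profile r because it is used twice: `modelDeriv` is again a model, with
profile iωr + r₁, so the same formula gives the second derivative. -/
theorem hasDerivAt_model {r : ℝ → ℂ} {r₁ : ℂ} (ψ ω : ℝ) {x : ℝ} (h : HasDerivAt r r₁ x) :
    HasDerivAt (model r ψ ω)
      (ψ * Complex.exp (Complex.I * ω * x) * (Complex.I * ω * r x + r₁)) x := by
  have := ((hasDerivAt_exp_I_mul ω x).const_mul (ψ : ℂ)).mul h
  exact this.congr_deriv (by ring)

theorem norm_exp_I_mul_sub_le (ω₁ ω₂ x : ℝ) :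
    ‖Complex.exp (Complex.I * ω₁ * x) - Complex.exp (Complex.I * ω₂ * x)‖ ≤ |ω₁ - ω₂| * |x| := by
  have h : Complex.exp (Complex.I * ω₁ * x) - Complex.exp (Complex.I * ω₂ * x) =
      Complex.exp (Complex.I * ω₂ * x) * (Complex.exp (Complex.I * ((ω₁ - ω₂) * x : ℝ)) - 1) := by
    rw [mul_sub, ← Complex.exp_add]
    push_cast
    ring_nf
  rw [h, norm_mul, norm_exp_I_mul, one_mul, ← abs_mul]
  exact Real.norm_exp_I_mul_ofReal_sub_one_le

theorem norm_model_sub_le {r : ℝ → ℂ} {C ψ₁ ψ₂ ω₁ ω₂ : ℝ} (hψ : |ψ₂| ≤ C) (x : ℝ) :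
    ‖model r ψ₁ ω₁ x - model r ψ₂ ω₂ x‖ ≤
      (|ψ₁ - ψ₂| + C * (|ω₁ - ω₂| * |x|)) * ‖r x‖ := by
  have h : model r ψ₁ ω₁ x - model r ψ₂ ω₂ x = (((ψ₁ - ψ₂ : ℝ) : ℂ) *
      Complex.exp (Complex.I * ω₁ * x) + ψ₂ *
      (Complex.exp (Complex.I * ω₁ * x) - Complex.exp (Complex.I * ω₂ * x))) * r x := by
    simp only [model]; push_cast; ring
  rw [h, norm_mul]
  gcongr
  refine (norm_add_le _ _).trans ?_
  rw [norm_mul, norm_mul, norm_exp_I_mul, Complex.norm_real, Complex.norm_real, mul_one,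
    Real.norm_eq_abs, Real.norm_eq_abs]
  gcongr
  · exact (abs_nonneg _).trans hψ
  · exact norm_exp_I_mul_sub_le _ _ _

namespace IsRapidSymbol

variable {r r₁ r₂ : ℝ → ℂ} {K : ℝ}

theorem hasDerivAt_model (hr : IsRapidSymbol r r₁ r₂ K) (ψ ω x : ℝ) :
    HasDerivAt (model r ψ ω) (modelDeriv r r₁ ψ ω x) x :=
  MellinShift.hasDerivAt_model ψ ω (hr.hasDerivAt x)

theorem norm_deriv_le (hr : IsRapidSymbol r r₁ r₂ K) {C ω : ℝ} (hω : |ω| ≤ C) (x : ℝ) :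
    ‖Complex.I * ω * r x + r₁ x‖ ≤ (C + 1) * K * Real.exp (-(2 * |x|)) := by
  refine (norm_add_le _ _).trans ?_
  rw [norm_mul, norm_mul, Complex.norm_I, one_mul, Complex.norm_real, Real.norm_eq_abs,
    add_mul, add_mul, one_mul, mul_assoc]
  have hC : 0 ≤ C := (abs_nonneg _).trans hω
  gcongr
  · exact hr.bound x
  · exact hr.bound₁ x

theorem norm_modelDeriv_le (hr : IsRapidSymbol r r₁ r₂ K) {C ψ ω : ℝ} (hψ : |ψ| ≤ C)
    (hω : |ω| ≤ C) (x : ℝ) :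
    ‖modelDeriv r r₁ ψ ω x‖ ≤ C * ((C + 1) * K) * Real.exp (-(2 * |x|)) := by
  have hC : 0 ≤ C := (abs_nonneg _).trans hω
  rw [modelDeriv, norm_mul, norm_mul, norm_exp_I_mul, Complex.norm_real, mul_one, mul_assoc C]
  exact mul_le_mul hψ (hr.norm_deriv_le hω x) (norm_nonneg _) hC

/-- The Lipschitz dependence of `model r ψ ω` on `ψ` and `ω` in the norm of `V(ℝ)`. -/
theorem vNorm_model_sub_le (hr : IsRapidSymbol r r₁ r₂ K) {C ψ₁ ψ₂ ω₁ ω₂ : ℝ} (hψ : |ψ₂| ≤ C)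
    (hω₁ : |ω₁| ≤ C) :
    vNorm (model r ψ₁ ω₁ - model r ψ₂ ω₂) ≤
      ENNReal.ofReal ((|ψ₁ - ψ₂| + C * |ω₁ - ω₂|) * ((C + 2) * K) * expMass) := by
  have hC : 0 ≤ C := (abs_nonneg _).trans hω₁
  have hK := hr.nonneg
  -- Absorbs the factor |x| coming from the difference of exponentials into the decay.
  have key (b : ℝ) (hb : 0 ≤ b) (x : ℝ) (q : ℝ) (hq : q ≤ b * Real.exp (-(2 * |x|))) :
      (|ψ₁ - ψ₂| + C * (|ω₁ - ω₂| * |x|)) * q ≤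
        (|ψ₁ - ψ₂| + C * |ω₁ - ω₂|) * b * Real.exp (-|x|) := by
    calc (|ψ₁ - ψ₂| + C * (|ω₁ - ω₂| * |x|)) * q
        ≤ (|ψ₁ - ψ₂| + C * (|ω₁ - ω₂| * |x|)) * (b * Real.exp (-(2 * |x|))) := by gcongr
      _ = |ψ₁ - ψ₂| * b * Real.exp (-(2 * |x|)) +
          C * |ω₁ - ω₂| * b * (|x| * Real.exp (-(2 * |x|))) := by ring
      _ ≤ |ψ₁ - ψ₂| * b * Real.exp (-|x|) + C * |ω₁ - ω₂| * b * Real.exp (-|x|) := by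
          gcongr
          · linarith [abs_nonneg x]
          · exact mul_exp_neg_two_mul_le |x|
      _ = _ := by ring
  refine vNorm_le (by positivity)
    (fun x => (hr.hasDerivAt_model ψ₁ ω₁ x).sub (hr.hasDerivAt_model ψ₂ ω₂ x)) (fun x => ?_)
    (fun x => ?_)
  · refine (norm_model_sub_le hψ x).trans ((key K hK x _ (hr.bound x)).trans ?_)
    gcongr
    nlinarith
  -- The difference of derivatives is a difference of two models with the common profile iω₁r + r₁,
  -- plus the error made by using ω₁ in the second profile. The first costs (C + 1)K, the error one
  -- more K, whence C + 2.
  · have h : modelDeriv r r₁ ψ₁ ω₁ x - modelDeriv r r₁ ψ₂ ω₂ x =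
        (model (fun x => Complex.I * ω₁ * r x + r₁ x) ψ₁ ω₁ x
          - model (fun x => Complex.I * ω₁ * r x + r₁ x) ψ₂ ω₂ x)
        + ψ₂ * Complex.exp (Complex.I * ω₂ * x) * (Complex.I * (ω₁ - ω₂ : ℝ) * r x) := by
      simp only [modelDeriv, model]
      push_cast
      ring
    rw [h]
    refine (norm_add_le _ _).trans ?_
    have h1 := (norm_model_sub_le (r := fun x => Complex.I * ω₁ * r x + r₁ x) (ψ₁ := ψ₁)
      (ω₁ := ω₁) (ω₂ := ω₂) hψ x).trans
      (key ((C + 1) * K) (by positivity) x _ (hr.norm_deriv_le hω₁ x))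
    have h2 : ‖(ψ₂ : ℂ) * Complex.exp (Complex.I * ω₂ * x) * (Complex.I * (ω₁ - ω₂ : ℝ) * r x)‖ ≤
        C * |ω₁ - ω₂| * K * Real.exp (-|x|) := by
      rw [norm_mul, norm_mul, norm_mul, norm_mul, norm_exp_I_mul, Complex.norm_I, one_mul, mul_one,
        Complex.norm_real, Complex.norm_real, Real.norm_eq_abs, Real.norm_eq_abs, mul_assoc,
        mul_assoc]
      gcongr
      refine (hr.bound x).trans ?_
      gcongr
      linarith [abs_nonneg x]
    refine (add_le_add h1 h2).trans ?_
    rw [← add_mul]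
    gcongr
    nlinarith [mul_nonneg (abs_nonneg (ψ₁ - ψ₂)) hK]

theorem vNorm_model_le (hr : IsRapidSymbol r r₁ r₂ K) {C ψ ω : ℝ} (hψ : |ψ| ≤ C) (hω : |ω| ≤ C) :
    vNorm (model r ψ ω) ≤ ENNReal.ofReal (C * ((C + 2) * K) * expMass) := by
  have hC : 0 ≤ C := (abs_nonneg _).trans hω
  have hK := hr.nonneg
  have h := hr.vNorm_model_sub_le (ψ₁ := ψ) (ψ₂ := 0) (ω₂ := ω) (by simpa using hC) hω
  have h0 : model r 0 ω = 0 := by funext x; simp [model]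
  rw [h0, sub_zero] at h
  refine h.trans (ENNReal.ofReal_le_ofReal ?_)
  have := expMass_pos
  gcongr
  simpa using hψ

/-- Both the model and its derivative must move little under translation, so two derivatives are
needed; this is the role of `bound₂`. Each differentiation of e^{iωx} r costs at most a factor C +
1, whence the square. -/
theorem vNorm_model_translate_le (hr : IsRapidSymbol r r₁ r₂ K) {C ψ ω h : ℝ} (hψ : |ψ| ≤ C)
    (hω : |ω| ≤ C) (hh : |h| ≤ 1) :
    vNorm (fun x => model r ψ ω x - model r ψ ω (x + h)) ≤
      ENNReal.ofReal (C * ((C + 1) ^ 2 * K) * Real.exp 1 * |h| * expMass) := by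
  have hC : 0 ≤ C := (abs_nonneg _).trans hω
  have hK := hr.nonneg
  have h1 (x : ℝ) : ‖modelDeriv r r₁ ψ ω x‖ ≤ C * ((C + 1) ^ 2 * K) * Real.exp (-|x|) := by
    refine (hr.norm_modelDeriv_le hψ hω x).trans ?_
    gcongr
    · nlinarith
    · linarith [abs_nonneg x]
  have hr' : ∀ x, HasDerivAt (fun x => Complex.I * ω * r x + r₁ x)
      (Complex.I * ω * r₁ x + r₂ x) x := fun x =>
    ((hr.hasDerivAt x).const_mul (Complex.I * (ω : ℂ))).add (hr.hasDerivAt₁ x)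
  have h2 (x : ℝ) : ‖(ψ : ℂ) * Complex.exp (Complex.I * ω * x) *
      (Complex.I * ω * (Complex.I * ω * r x + r₁ x) + (Complex.I * ω * r₁ x + r₂ x))‖ ≤
      C * ((C + 1) ^ 2 * K) * Real.exp (-|x|) := by
    rw [norm_mul, norm_mul, norm_exp_I_mul, Complex.norm_real, mul_one, mul_assoc C]
    refine mul_le_mul hψ ?_ (norm_nonneg _) hC
    have h3 : ‖Complex.I * (ω : ℂ) * r₁ x + r₂ x‖ ≤ (C + 1) * K * Real.exp (-(2 * |x|)) := by
      refine (norm_add_le _ _).trans ?_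
      rw [norm_mul, norm_mul, Complex.norm_I, one_mul, Complex.norm_real, Real.norm_eq_abs,
        add_mul, add_mul, one_mul, mul_assoc]
      gcongr
      · exact hr.bound₁ x
      · exact hr.bound₂ x
    refine (norm_add_le _ _).trans ?_
    rw [norm_mul, norm_mul, Complex.norm_I, one_mul, Complex.norm_real, Real.norm_eq_abs]
    calc |ω| * ‖Complex.I * ω * r x + r₁ x‖ + ‖Complex.I * (ω : ℂ) * r₁ x + r₂ x‖
        ≤ C * ((C + 1) * K * Real.exp (-(2 * |x|))) + (C + 1) * K * Real.exp (-(2 * |x|)) := by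
          gcongr
          exact hr.norm_deriv_le hω x
      _ = (C + 1) ^ 2 * K * Real.exp (-(2 * |x|)) := by ring
      _ ≤ (C + 1) ^ 2 * K * Real.exp (-|x|) := by
          gcongr
          linarith [abs_nonneg x]
  have hdd : ∀ x : ℝ, HasDerivAt (modelDeriv r r₁ ψ ω) ((ψ : ℂ) * Complex.exp (Complex.I * ω * x) *
      (Complex.I * ω * (Complex.I * ω * r x + r₁ x) + (Complex.I * ω * r₁ x + r₂ x))) x :=
    fun x => MellinShift.hasDerivAt_model ψ ω (hr' x)
  have hD : 0 ≤ C * ((C + 1) ^ 2 * K) := by positivity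
  refine vNorm_le (by positivity) (fun x => (hr.hasDerivAt_model ψ ω x).fun_sub
    ((hr.hasDerivAt_model ψ ω (x + h)).comp_add_const x h)) (fun x => ?_) (fun x => ?_)
  · exact norm_sub_translate_le hD (hr.hasDerivAt_model ψ ω) h1 hh x
  · exact norm_sub_translate_le hD hdd h2 hh x

theorem lintegral_tail_le (hr : IsRapidSymbol r r₁ r₂ K) {C ψ ω m : ℝ} (hψ : |ψ| ≤ C)
    (hω : |ω| ≤ C) :
    ∫⁻ x in (Icc (-m) m)ᶜ, ‖_root_.deriv (model r ψ ω) x‖ₑ ≤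
      ENNReal.ofReal (C * ((C + 1) * K) * Real.exp (-m) * ∫ x : ℝ, Real.exp (-|x|)) := by
  have hC : 0 ≤ C := (abs_nonneg _).trans hω
  have hK := hr.nonneg
  have hdf : _root_.deriv (model r ψ ω) = modelDeriv r r₁ ψ ω :=
    funext fun x => (hr.hasDerivAt_model ψ ω x).deriv
  rw [hdf]
  refine lintegral_enorm_le_of_norm_le _ measurableSet_Icc.compl (by positivity) fun x hx => ?_
  refine (hr.norm_modelDeriv_le hψ hω x).trans ?_
  -- Off [-m, m] one has exp(-2|x|) ≤ exp(-m) exp(-|x|).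
  rw [mul_assoc _ (Real.exp (-m)), ← Real.exp_add]
  gcongr
  have : m ≤ |x| := by
    by_contra! h
    exact hx (abs_le.1 h.le)
  linarith

theorem memV_model (hr : IsRapidSymbol r r₁ r₂ K) (ψ ω : ℝ) : MemV (model r ψ ω) := by
  have hd : Differentiable ℝ (modelDeriv r r₁ ψ ω) := fun x =>
    (MellinShift.hasDerivAt_model (r := fun x => Complex.I * ω * r x + r₁ x) ψ ω
      (((hr.hasDerivAt x).const_mul (Complex.I * (ω : ℂ))).add
        (hr.hasDerivAt₁ x))).differentiableAt
  have hdf : _root_.deriv (model r ψ ω) = modelDeriv r r₁ ψ ω :=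
    funext fun x => (hr.hasDerivAt_model ψ ω x).deriv
  refine ⟨fun u v => ?_, ?_⟩
  · refine ContDiffOn.absolutelyContinuousOnInterval (ContDiff.contDiffOn ?_)
    rw [contDiff_one_iff_deriv, hdf]
    exact ⟨fun x => (hr.hasDerivAt_model ψ ω x).differentiableAt, hd.continuous⟩
  · rw [hdf]
    set C := max |ψ| |ω| with hCdef
    refine (integrable_exp_neg_abs.const_mul (C * ((C + 1) * K))).mono'
      hd.continuous.aestronglyMeasurable (Eventually.of_forall fun x => ?_)
    have hC : 0 ≤ C := (abs_nonneg _).trans (le_max_left _ _)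
    have hK := hr.nonneg
    refine (hr.norm_modelDeriv_le (le_max_left _ _) (le_max_right _ _) x).trans ?_
    gcongr
    linarith [abs_nonneg x]

end IsRapidSymbol

/-- `f` oscillates slowly along the filter `l` (at `0` or at `∞`). -/
def SlowlyOscillates (l : Filter ℝ) (f : ℝ → ℝ) : Prop :=
  ∀ ε > 0, ∀ᶠ s in l, ∀ t ∈ Icc s (2 * s), ∀ τ ∈ Icc s (2 * s), |f t - f τ| ≤ ε

theorem tendsto_ofReal_const_mul {l : Filter ℝ} {g : ℝ → ℝ} (A : ℝ) (h : Tendsto g l (𝓝 0)) :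
    Tendsto (fun s => ENNReal.ofReal (A * g s)) l (𝓝 0) := by
  have := (ENNReal.continuous_ofReal.tendsto _).comp (h.const_mul A)
  simpa [Function.comp_def] using this

theorem IsRapidSymbol.tendsto_oscillation {r r₁ r₂ : ℝ → ℂ} {K C : ℝ}
    (hr : IsRapidSymbol r r₁ r₂ K) {ψ ω : ℝ → ℝ} (hψ : ∀ t > 0, |ψ t| ≤ C)
    (hω : ∀ t > 0, |ω t| ≤ C) {l : Filter ℝ} (hl : ∀ᶠ s in l, 0 < s)
    (hψl : SlowlyOscillates l ψ) (hωl : SlowlyOscillates l ω) :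
    Tendsto (fun s : ℝ => ⨆ t ∈ Icc s (2 * s), ⨆ τ ∈ Icc s (2 * s),
      eLpNorm (model r (ψ t) (ω t) - model r (ψ τ) (ω τ)) ∞ volume) l (𝓝 0) := by
  have hC : 0 ≤ C := (abs_nonneg _).trans (hψ 1 one_pos)
  have hK := hr.nonneg
  have hM := expMass_pos
  rw [ENNReal.tendsto_nhds_zero]
  intro ε hε
  have h1 : Tendsto (fun δ : ℝ => ENNReal.ofReal ((1 + C) * ((C + 2) * K) * expMass * δ))
      (𝓝[>] 0) (𝓝 0) := tendsto_ofReal_const_mul _ (tendsto_id.mono_left nhdsWithin_le_nhds)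
  obtain ⟨δ, hδε, hδ⟩ := ((h1.eventually_le_const hε).and self_mem_nhdsWithin).exists
  filter_upwards [hl, hψl δ hδ, hωl δ hδ] with s hs h2 h3
  refine iSup₂_le fun t ht => iSup₂_le fun τ hτ => ?_
  refine (eLpNorm_top_le_vNorm _).trans ((hr.vNorm_model_sub_le (hψ τ (hs.trans_le hτ.1))
    (hω t (hs.trans_le ht.1))).trans (le_trans (ENNReal.ofReal_le_ofReal ?_) hδε))
  have h4 := h2 t ht τ hτ
  have h5 := h3 t ht τ hτ
  calc (|ψ t - ψ τ| + C * |ω t - ω τ|) * ((C + 2) * K) * expMass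
      ≤ (δ + C * δ) * ((C + 2) * K) * expMass := by gcongr
    _ = _ := by ring

theorem memETilde_model {r r₁ r₂ : ℝ → ℂ} {K C : ℝ} (hr : IsRapidSymbol r r₁ r₂ K)
    {ψ ω : ℝ → ℝ} (hψ : ∀ t > 0, |ψ t| ≤ C) (hω : ∀ t > 0, |ω t| ≤ C)
    (hψc : ∀ t > 0, ContinuousAt ψ t) (hωc : ∀ t > 0, ContinuousAt ω t)
    (hψ0 : SlowlyOscillates (𝓝[>] 0) ψ) (hω0 : SlowlyOscillates (𝓝[>] 0) ω)
    (hψt : SlowlyOscillates atTop ψ) (hωt : SlowlyOscillates atTop ω) :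
    MemETilde (fun t => model r (ψ t) (ω t)) where
  memV t _ := hr.memV_model _ _
  bounded := by
    refine lt_of_le_of_lt (iSup₂_le fun t ht => hr.vNorm_model_le (hψ t ht) (hω t ht))
      ENNReal.ofReal_lt_top
  continuous t ht := by
    have h1 : Tendsto (fun τ => |ψ τ - ψ t| + C * |ω τ - ω t|) (𝓝 t) (𝓝 0) := by
      have := ((((hψc t ht).tendsto).sub_const (ψ t)).abs).add
        (((((hωc t ht).tendsto).sub_const (ω t)).abs).const_mul C)
      simpa using this
    refine tendsto_of_tendsto_of_tendsto_of_le_of_le' tendsto_const_nhds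
      (tendsto_ofReal_const_mul (((C + 2) * K) * expMass) h1)
      (Eventually.of_forall fun _ => bot_le) ?_
    filter_upwards [Ioi_mem_nhds ht] with τ hτ
    refine (hr.vNorm_model_sub_le (hψ t ht) (hω τ hτ)).trans (le_of_eq ?_)
    ring_nf
  oscillation_zero := hr.tendsto_oscillation hψ hω self_mem_nhdsWithin hψ0 hω0
  oscillation_infty := hr.tendsto_oscillation hψ hω (eventually_gt_atTop 0) hψt hωt
  translation := by
    have h1 : Tendsto (fun h : ℝ => |h|) (𝓝 0) (𝓝 0) := by
      simpa using (continuous_abs.tendsto (0 : ℝ))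
    refine tendsto_of_tendsto_of_tendsto_of_le_of_le' tendsto_const_nhds
      (tendsto_ofReal_const_mul (C * ((C + 1) ^ 2 * K) * Real.exp 1 * expMass) h1)
      (Eventually.of_forall fun _ => bot_le) ?_
    filter_upwards [h1.eventually_le_const one_pos] with h hh
    refine iSup₂_le fun t ht => (hr.vNorm_model_translate_le (hψ t ht) (hω t ht) hh).trans
      (le_of_eq ?_)
    ring_nf
  tail := by
    refine tendsto_of_tendsto_of_tendsto_of_le_of_le' tendsto_const_nhds
      (tendsto_ofReal_const_mul (C * ((C + 1) * K) * ∫ x : ℝ, Real.exp (-|x|))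
        Real.tendsto_exp_neg_atTop_nhds_zero)
      (Eventually.of_forall fun _ => bot_le) (Eventually.of_forall fun m => ?_)
    refine iSup₂_le fun t ht => (hr.lintegral_tail_le (hψ t ht) (hω t ht)).trans (le_of_eq ?_)
    ring_nf

/-! ### Slow oscillation -/

/-- The properties of the neighbourhoods of `0` and `∞` used for slow oscillation. -/
structure IsEnd (l : Filter ℝ) : Prop where
  pos : ∀ᶠ s in l, 0 < s
  dyadic : ∀ P : ℝ → Prop, (∀ᶠ t in l, P t) → ∀ᶠ s in l, ∀ t ∈ Icc s (2 * s), P t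

theorem isEnd_zero : IsEnd (𝓝[>] (0 : ℝ)) where
  pos := self_mem_nhdsWithin
  dyadic P hP := by
    obtain ⟨u, hu, hP⟩ := (eventually_nhdsWithin_iff.1 hP |> Metric.eventually_nhds_iff.1)
    have h : ∀ᶠ s in 𝓝[>] (0 : ℝ), s < u / 2 :=
      mem_nhdsWithin_of_mem_nhds (Iio_mem_nhds (by positivity))
    filter_upwards [h, self_mem_nhdsWithin] with s hs hs0 t ht
    have hs0' : 0 < s := hs0
    have ht0 : 0 < t := hs0'.trans_le ht.1
    refine hP ?_ ht0
    rw [Real.dist_eq, sub_zero, abs_of_pos ht0]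
    linarith [ht.2]

theorem isEnd_atTop : IsEnd (atTop : Filter ℝ) where
  pos := eventually_gt_atTop 0
  dyadic P hP := by
    obtain ⟨u, hu⟩ := eventually_atTop.1 hP
    filter_upwards [eventually_ge_atTop u] with s hs t ht
    exact hu t (hs.trans ht.1)

/-- Uniform continuity of g on the compact set K transfers the oscillation estimate. It is applied
to the logarithm and to the power 1/p. -/
theorem SlowlyOscillates.comp {l : Filter ℝ} (hl : IsEnd l) {f g : ℝ → ℝ} {K : Set ℝ}
    (hf : SlowlyOscillates l f) (hK : IsCompact K) (hg : ContinuousOn g K)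
    (hfK : ∀ t > 0, f t ∈ K) : SlowlyOscillates l (fun t => g (f t)) := by
  intro ε hε
  obtain ⟨δ, hδ, h⟩ := Metric.uniformContinuousOn_iff_le.1
    (hK.uniformContinuousOn_of_continuous hg) ε hε
  filter_upwards [hf δ hδ, hl.pos] with s hs hs0 t ht τ hτ
  exact h _ (hfK t (hs0.trans_le ht.1)) _ (hfK τ (hs0.trans_le hτ.1)) (hs t ht τ hτ)

theorem slowlyOscillates_of_tendsto {l : Filter ℝ} (hl : IsEnd l) {f : ℝ → ℝ} {a : ℝ}
    (hf : Tendsto f l (𝓝 a)) : SlowlyOscillates l f := by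
  intro ε hε
  have h : ∀ᶠ t in l, |f t - a| < ε / 2 := by
    simpa [Real.dist_eq] using Metric.tendsto_nhds.1 hf (ε / 2) (by positivity)
  filter_upwards [hl.dyadic _ h] with s hs t ht τ hτ
  have h1 := abs_lt.1 (hs t ht)
  have h2 := abs_lt.1 (hs τ hτ)
  exact abs_le.2 ⟨by linarith, by linarith⟩

theorem eventually_abs_sub_le {l : Filter ℝ} {f : ℝ → ℝ} {lam : ℝ}
    (h : Tendsto (fun r : ℝ => ⨆ t ∈ Icc (lam * r) r, ⨆ τ ∈ Icc (lam * r) r,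
      ‖Complex.ofReal (f t) - Complex.ofReal (f τ)‖ₑ) l (𝓝 0)) {ε : ℝ} (hε : 0 < ε) :
    ∀ᶠ r in l, ∀ t ∈ Icc (lam * r) r, ∀ τ ∈ Icc (lam * r) r, |f t - f τ| ≤ ε := by
  filter_upwards [h.eventually_le_const (ENNReal.ofReal_pos.2 hε)] with r hr t ht τ hτ
  have h1 : ‖Complex.ofReal (f t) - Complex.ofReal (f τ)‖ₑ ≤ ENNReal.ofReal ε :=
    le_trans (le_trans (le_iSup₂ (f := fun τ (_ : τ ∈ Icc (lam * r) r) =>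
      ‖Complex.ofReal (f t) - Complex.ofReal (f τ)‖ₑ) τ hτ)
      (le_iSup₂ (f := fun t (_ : t ∈ Icc (lam * r) r) => ⨆ τ ∈ Icc (lam * r) r,
        ‖Complex.ofReal (f t) - Complex.ofReal (f τ)‖ₑ) t ht)) hr
  rw [← Complex.ofReal_sub, ← ofReal_norm, Complex.norm_real] at h1
  exact (ENNReal.ofReal_le_ofReal_iff hε.le).1 h1

/-- The slow oscillation of real functions, on all intervals `[lam * r, r]`. -/
def SlowlyOscillatesAllScales (l : Filter ℝ) (f : ℝ → ℝ) : Prop :=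
  ∀ lam : ℝ, 0 < lam → lam < 1 → ∀ ε > 0,
    ∀ᶠ r in l, ∀ t ∈ Icc (lam * r) r, ∀ τ ∈ Icc (lam * r) r, |f t - f τ| ≤ ε

theorem SlowlyOscillatesAllScales.slowlyOscillates {l : Filter ℝ} (hl : IsEnd l) {f : ℝ → ℝ}
    (hf : SlowlyOscillatesAllScales l f) : SlowlyOscillates l f := by
  intro ε hε
  -- The interval [s, 2s] is [lam r, r] with lam = 1/2 and r = 2s; `dyadic` moves the estimate from
  -- r to s = r/2.
  filter_upwards [hl.dyadic _ (hf (1 / 2) (by norm_num) (by norm_num) ε hε), hl.pos]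
    with s hs hs0 t ht τ hτ
  have h := hs (2 * s) ⟨by linarith, le_rfl⟩
  have h2 : 1 / 2 * (2 * s) = s := by ring
  rw [h2] at h
  exact h t ht τ hτ

/-! ### Slowly oscillating shifts -/

namespace IsSOS

variable {α : ℝ → ℝ}

theorem hasDerivAt (hα : IsSOS α) {t : ℝ} (ht : 0 < t) : HasDerivAt α (deriv α t) t :=
  ((hα.contDiffOn.differentiableOn one_ne_zero).differentiableAt (Ioi_mem_nhds ht)).hasDerivAt

theorem pos (hα : IsSOS α) {t : ℝ} (ht : 0 < t) : 0 < α t := hα.bijOn.mapsTo ht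

theorem continuousOn_deriv (hα : IsSOS α) : ContinuousOn (deriv α) (Ioi 0) :=
  hα.contDiffOn.continuousOn_deriv_of_isOpen isOpen_Ioi le_rfl

theorem exists_deriv_bounds (hα : IsSOS α) :
    ∃ m M : ℝ, 0 < m ∧ m ≤ M ∧ ∀ t > 0, deriv α t ∈ Icc m M := by
  obtain ⟨C, hC⟩ := hα.log_deriv_bounded
  have hC0 : 0 ≤ C := (abs_nonneg _).trans (hC 1 one_pos)
  refine ⟨Real.exp (-C), Real.exp C, Real.exp_pos _, Real.exp_le_exp.2 (by linarith),
    fun t ht => ?_⟩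
  have h := abs_le.1 (hC t ht)
  have hp := hα.deriv_pos t ht
  exact ⟨(Real.le_log_iff_exp_le hp).1 h.1, (Real.log_le_iff_le_exp hp).1 h.2⟩

theorem exists_deriv_eq_slope (hα : IsSOS α) {s t : ℝ} (hs : 0 < s) (hst : s < t) :
    ∃ ξ ∈ Ioo s t, α t - α s = deriv α ξ * (t - s) := by
  obtain ⟨ξ, hξ, h⟩ := _root_.exists_deriv_eq_slope α hst
    (fun x hx => (hα.hasDerivAt (hs.trans_le hx.1)).continuousAt.continuousWithinAt)
    (fun x hx => (hα.hasDerivAt (hs.trans hx.1)).differentiableAt.differentiableWithinAt)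
  refine ⟨ξ, hξ, ?_⟩
  rw [h, div_mul_cancel₀ _ (sub_pos.2 hst).ne']

theorem strictMonoOn (hα : IsSOS α) : StrictMonoOn α (Ioi 0) := by
  intro s hs t _ hst
  obtain ⟨ξ, hξ, h⟩ := hα.exists_deriv_eq_slope hs hst
  have := mul_pos (hα.deriv_pos ξ (lt_trans hs hξ.1)) (sub_pos.2 hst)
  linarith

/-- Apply the mean value theorem on [s, t] and let s be small. The lower bound uses only α(s) > 0,
while the upper bound needs α(s) arbitrarily small, which surjectivity provides. -/
theorem div_mem_Icc (hα : IsSOS α) {m M : ℝ} (h : ∀ t > 0, deriv α t ∈ Icc m M) {t : ℝ}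
    (ht : 0 < t) : α t / t ∈ Icc m M := by
  constructor
  · rw [le_div_iff₀ ht]
    have h1 : Tendsto (fun s => m * (t - s)) (𝓝[>] 0) (𝓝 (m * (t - 0))) :=
      (Continuous.tendsto (by fun_prop) 0).mono_left nhdsWithin_le_nhds
    rw [sub_zero] at h1
    refine le_of_tendsto h1 ?_
    filter_upwards [Ioo_mem_nhdsGT ht] with s hs
    obtain ⟨ξ, hξ, he⟩ := hα.exists_deriv_eq_slope hs.1 hs.2
    have := mul_le_mul_of_nonneg_right (h ξ (hs.1.trans hξ.1)).1 (sub_pos.2 hs.2).le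
    linarith [hα.pos hs.1]
  · rw [div_le_iff₀ ht]
    refine le_of_forall_pos_le_add fun ε hε => ?_
    -- The bound by half of α(t) forces s < t by monotonicity.
    obtain ⟨s, hs, hse⟩ := hα.bijOn.surjOn (mem_Ioi.2 (lt_min hε (half_pos (hα.pos ht))))
    have hs0 : 0 < s := hs
    have hst : s < t := by
      rw [← hα.strictMonoOn.lt_iff_lt hs ht, hse]
      exact (min_le_right _ _).trans_lt (half_lt_self (hα.pos ht))
    obtain ⟨ξ, hξ, he⟩ := hα.exists_deriv_eq_slope hs0 hst
    have h1 := mul_le_mul_of_nonneg_right (h ξ (hs0.trans hξ.1)).2 (sub_pos.2 hst).le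
    have h2 : 0 < M := (hα.deriv_pos t ht).trans_le (h t ht).2
    have h3 : α s ≤ ε := hse ▸ min_le_left _ _
    nlinarith

theorem slowlyOscillatesAllScales_zero (hα : IsSOS α) :
    SlowlyOscillatesAllScales (𝓝[>] 0) (deriv α) := fun lam h0 h1 _ hε =>
  eventually_abs_sub_le (hα.deriv_memSO.oscillation_zero lam h0 h1) hε

theorem slowlyOscillatesAllScales_atTop (hα : IsSOS α) :
    SlowlyOscillatesAllScales atTop (deriv α) := fun lam h0 h1 _ hε =>
  eventually_abs_sub_le (hα.deriv_memSO.oscillation_infty lam h0 h1) hε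

/-- The mean value theorem on [lam t, t] gives α(t)/t = (1 - lam) α'(ξ) + lam · α(lam t)/(lam t).
The terms with the factor lam are small because α' and α(t)/t are bounded, and α'(ξ) is close to
α'(t) by slow oscillation. Since lam must be arbitrarily small, oscillation on dyadic intervals
alone is not invoked here. -/
theorem tendsto_div_sub_deriv (hα : IsSOS α) {l : Filter ℝ} (hl : IsEnd l)
    (h : SlowlyOscillatesAllScales l (deriv α)) :
    Tendsto (fun t => α t / t - deriv α t) l (𝓝 0) := by
  obtain ⟨m, M, hm, hmM, hb⟩ := hα.exists_deriv_bounds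
  have hM : 0 < M := hm.trans_le hmM
  rw [Metric.tendsto_nhds]
  intro ε hε
  -- The first entry keeps lam < 1; the second makes each of the two error terms at most ε/8.
  set lam : ℝ := min (1 / 2) (ε / (8 * M)) with hlam
  have hlam0 : 0 < lam := by positivity
  have hlam1 : lam < 1 := (min_le_left _ _).trans_lt (by norm_num)
  have hlamM : lam * M ≤ ε / 8 := by
    have : lam ≤ ε / (8 * M) := min_le_right _ _
    calc lam * M ≤ ε / (8 * M) * M := by gcongr
      _ = ε / 8 := by field_simp
  filter_upwards [h lam hlam0 hlam1 (ε / 2) (by positivity), hl.pos] with t ht ht0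
  have h0 : 0 < lam * t := by positivity
  have h1 : lam * t < t := by nlinarith
  obtain ⟨ξ, hξ, he⟩ := hα.exists_deriv_eq_slope h0 h1
  have h2 := ht ξ ⟨hξ.1.le, hξ.2.le⟩ t ⟨h1.le, le_rfl⟩
  have h3 := hb ξ (h0.trans hξ.1)
  have h4 := hα.div_mem_Icc hb h0
  have h5 : α t / t = deriv α ξ - lam * deriv α ξ + lam * (α (lam * t) / (lam * t)) := by
    generalize α (lam * t) = b at he
    field_simp
    linarith
  have h6 := abs_le.1 h2
  have h7 : lam * deriv α ξ ≤ lam * M := by gcongr; exact h3.2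
  have h8 : lam * (α (lam * t) / (lam * t)) ≤ lam * M := by gcongr; exact h4.2
  have h9 : 0 ≤ lam * deriv α ξ := mul_nonneg hlam0.le (hm.le.trans h3.1)
  have h10 : 0 ≤ lam * (α (lam * t) / (lam * t)) := mul_nonneg hlam0.le (hm.le.trans h4.1)
  rw [Real.dist_eq, sub_zero, h5, abs_lt]
  constructor <;> linarith

theorem slowlyOscillates_div (hα : IsSOS α) {l : Filter ℝ} (hl : IsEnd l)
    (h : SlowlyOscillatesAllScales l (deriv α)) : SlowlyOscillates l (fun t => α t / t) := by
  intro ε hε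
  filter_upwards [h.slowlyOscillates hl (ε / 2) (by positivity), slowlyOscillates_of_tendsto hl
    (hα.tendsto_div_sub_deriv hl h) (ε / 2) (by positivity)] with s h1 h2 t ht τ hτ
  have h3 := abs_le.1 (h1 t ht τ hτ)
  have h4 := abs_le.1 (h2 t ht τ hτ)
  exact abs_le.2 ⟨by linarith, by linarith⟩

theorem one_add_mul_deriv_shiftExponent (hα : IsSOS α) {t : ℝ} (ht : 0 < t) :
    1 + t * deriv (shiftExponent α) t = deriv α t / (α t / t) := by
  have h0 := (hα.pos ht).ne'
  have h := (((hα.hasDerivAt ht).fun_div (hasDerivAt_id' t) ht.ne').log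
    (div_ne_zero h0 ht.ne')).deriv
  have h' : deriv (shiftExponent α) t = _ := h
  rw [h']
  field_simp
  ring

theorem continuousAt_div (hα : IsSOS α) {t : ℝ} (ht : 0 < t) :
    ContinuousAt (fun t => α t / t) t :=
  (hα.hasDerivAt ht).continuousAt.div continuousAt_id ht.ne'

/-- The function equals α'(t) / (α(t)/t). Numerator and denominator are asymptotically equal and the
denominator is at least m > 0, so it even converges to 1. -/
theorem slowlyOscillates_density (hα : IsSOS α) {l : Filter ℝ} (hl : IsEnd l)
    (h : SlowlyOscillatesAllScales l (deriv α)) :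
    SlowlyOscillates l (fun t => 1 + t * deriv (shiftExponent α) t) := by
  obtain ⟨m, M, hm, hmM, hb⟩ := hα.exists_deriv_bounds
  refine slowlyOscillates_of_tendsto hl (a := 1) ?_
  have h1 : Tendsto (fun t => m⁻¹ * |α t / t - deriv α t|) l (𝓝 0) := by
    simpa using ((hα.tendsto_div_sub_deriv hl h).abs).const_mul m⁻¹
  rw [tendsto_iff_dist_tendsto_zero]
  refine squeeze_zero' (Eventually.of_forall fun _ => dist_nonneg) ?_ h1
  filter_upwards [hl.pos] with t ht
  have h2 := (hα.div_mem_Icc hb ht).1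
  have h3 : 0 < α t / t := hm.trans_le h2
  rw [hα.one_add_mul_deriv_shiftExponent ht, Real.dist_eq, div_sub_one h3.ne', abs_div,
    abs_of_pos h3, abs_sub_comm, div_eq_inv_mul]
  gcongr

end IsSOS

/-- By definition `cSymbol` is a model with profile r_γ. The bounds m ≤ α' ≤ M confine α(t)/t to [m,
M] and 1 + tω'(t) to [m/M, M/m], compact subsets of (0, ∞) on which the logarithm and the power are
uniformly continuous. -/
theorem memETilde_cSymbol {p : ℝ} (hp : 1 < p) {γ : ℂ}
    (hγ0 : 0 < 1 / p + γ.re) (hγ1 : 1 / p + γ.re < 1) {α : ℝ → ℝ} (hα : IsSOS α) :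
    MemETilde (cSymbol p γ (shiftExponent α)) := by
  obtain ⟨r₁, r₂, K, hr⟩ := exists_isRapidSymbol_rSymbol hγ0 hγ1
  obtain ⟨m, M, hm, hmM, hb⟩ := hα.exists_deriv_bounds
  have hM : 0 < M := hm.trans_le hmM
  have hp' : 0 ≤ 1 / p := by positivity
  have hq : ∀ t > 0, 1 + t * deriv (shiftExponent α) t ∈ Icc (m / M) (M / m) := by
    intro t ht
    rw [hα.one_add_mul_deriv_shiftExponent ht]
    have h1 := hα.div_mem_Icc hb ht
    have h2 := hb t ht
    have h3 : 0 < α t / t := hm.trans_le h1.1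
    exact ⟨div_le_div₀ (hm.le.trans h2.1) h2.1 h3 h1.2, div_le_div₀ hM.le h2.2 hm h1.1⟩
  have hlog : ContinuousOn Real.log (Icc m M) :=
    Real.continuousOn_log.mono fun x hx => (hm.trans_le hx.1).ne'
  have hrpow : ContinuousOn (fun x : ℝ => x ^ (1 / p)) (Icc (m / M) (M / m)) :=
    (Real.continuous_rpow_const hp').continuousOn
  obtain ⟨C₁, hC₁⟩ := isCompact_Icc.exists_bound_of_continuousOn hlog
  obtain ⟨C₂, hC₂⟩ := isCompact_Icc.exists_bound_of_continuousOn hrpow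
  have hω (l : Filter ℝ) (hl : IsEnd l) (h : SlowlyOscillatesAllScales l (deriv α)) :
      SlowlyOscillates l (shiftExponent α) :=
    (hα.slowlyOscillates_div hl h).comp hl isCompact_Icc hlog fun t ht => hα.div_mem_Icc hb ht
  have hψ (l : Filter ℝ) (hl : IsEnd l) (h : SlowlyOscillatesAllScales l (deriv α)) :
      SlowlyOscillates l (fun t => (1 + t * deriv (shiftExponent α) t) ^ (1 / p)) :=
    (hα.slowlyOscillates_density hl h).comp hl isCompact_Icc hrpow hq
  refine memETilde_model (C := max C₁ C₂)
    (ψ := fun t => (1 + t * deriv (shiftExponent α) t) ^ (1 / p)) (ω := shiftExponent α) hr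
    (fun t ht => (hC₂ _ (hq t ht)).trans (le_max_right _ _))
    (fun t ht => (hC₁ _ (hα.div_mem_Icc hb ht)).trans (le_max_left _ _))
    (fun t ht => ?_) (fun t ht => ?_)
    (hψ _ isEnd_zero hα.slowlyOscillatesAllScales_zero)
    (hω _ isEnd_zero hα.slowlyOscillatesAllScales_zero)
    (hψ _ isEnd_atTop hα.slowlyOscillatesAllScales_atTop)
    (hω _ isEnd_atTop hα.slowlyOscillatesAllScales_atTop)
  · refine ContinuousAt.rpow_const ?_ (Or.inr hp')
    have h1 : ContinuousAt (fun t => deriv α t / (α t / t)) t :=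
      (hα.continuousOn_deriv.continuousAt (Ioi_mem_nhds ht)).div (hα.continuousAt_div ht)
        (div_pos (hα.pos ht) ht).ne'
    refine h1.congr ?_
    filter_upwards [Ioi_mem_nhds ht] with s hs
    rw [hα.one_add_mul_deriv_shiftExponent hs]
  · exact (hα.continuousAt_div ht).log (div_pos (hα.pos ht) ht).ne'

/-! ### Change of variables on the half-line -/

/-- A differentiable bijection of `(0, ∞)` with positive derivative. -/
structure IsPosDiffeo (β : ℝ → ℝ) : Prop where
  bijOn : BijOn β (Ioi 0) (Ioi 0)
  differentiableAt : ∀ t > 0, DifferentiableAt ℝ β t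
  deriv_pos : ∀ t > 0, 0 < deriv β t

namespace IsPosDiffeo

variable {β : ℝ → ℝ}

theorem pos (hβ : IsPosDiffeo β) {t : ℝ} (ht : 0 < t) : 0 < β t := hβ.bijOn.mapsTo ht

theorem lintegral_comp (hβ : IsPosDiffeo β) (g : ℝ → ℝ≥0∞) :
    ∫⁻ t, ENNReal.ofReal (deriv β t) * g (β t) ∂volPlus = ∫⁻ s, g s ∂volPlus := by
  have h := lintegral_image_eq_lintegral_abs_deriv_mul measurableSet_Ioi
    (fun t ht => (hβ.differentiableAt t ht).hasDerivAt.hasDerivWithinAt) hβ.bijOn.injOn g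
  rw [hβ.bijOn.image_eq] at h
  rw [volPlus, h]
  refine setLIntegral_congr_fun measurableSet_Ioi fun t ht => ?_
  simp only [abs_of_pos (hβ.deriv_pos t ht)]

theorem aemeasurable (hβ : IsPosDiffeo β) : AEMeasurable β volPlus :=
  ContinuousOn.aemeasurable
    (fun t ht => (hβ.differentiableAt t ht).continuousAt.continuousWithinAt) measurableSet_Ioi

/-- Change of variables for the indicator of a null set Z shows that β' · (1_Z ∘ β) vanishes almost
everywhere, and β' > 0. Composition with β is thereby well defined on classes of functions. -/
theorem ae_comp (hβ : IsPosDiffeo β) {P : ℝ → Prop} (h : ∀ᵐ s ∂volPlus, P s) :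
    ∀ᵐ t ∂volPlus, P (β t) := by
  obtain ⟨Z, hPZ, hZ, hZ0⟩ := exists_measurable_superset_of_null (ae_iff.1 h)
  have h1 : ∫⁻ t, ENNReal.ofReal (deriv β t) * Z.indicator 1 (β t) ∂volPlus = 0 := by
    rw [hβ.lintegral_comp, lintegral_indicator_one hZ, hZ0]
  replace h1 := (lintegral_eq_zero_iff' ((measurable_deriv β).ennreal_ofReal.aemeasurable.mul
    ((measurable_one.indicator hZ).comp_aemeasurable hβ.aemeasurable))).1 h1
  filter_upwards [h1, ae_pos] with t ht ht0
  by_contra hP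
  have h2 : β t ∈ Z := hPZ hP
  have h3 := hβ.deriv_pos t ht0
  simp [h2] at ht
  linarith

theorem aestronglyMeasurable_comp (hβ : IsPosDiffeo β) {f : ℝ → ℂ}
    (hf : AEStronglyMeasurable f volPlus) :
    AEStronglyMeasurable (fun t => f (β t)) volPlus := by
  refine AEStronglyMeasurable.congr
    (hf.stronglyMeasurable_mk.aestronglyMeasurable.comp_aemeasurable hβ.aemeasurable) ?_
  filter_upwards [hβ.ae_comp hf.ae_eq_mk] with t ht using ht.symm

theorem aestronglyMeasurable_weightedShift (hβ : IsPosDiffeo β) (p : ℝ) {f : ℝ → ℂ}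
    (hf : AEStronglyMeasurable f volPlus) :
    AEStronglyMeasurable (weightedShift p β f) volPlus := by
  have h : Measurable fun t : ℝ => ((deriv β t ^ (1 / p) : ℝ) : ℂ) := by
    have := measurable_deriv β
    fun_prop
  exact h.aestronglyMeasurable.mul (hβ.aestronglyMeasurable_comp hf)

theorem eLpNorm_weightedShift (hβ : IsPosDiffeo β) {p : ℝ} (hp0 : 0 < p) (f : ℝ → ℂ) :
    eLpNorm (weightedShift p β f) (ENNReal.ofReal p) volPlus =
      eLpNorm f (ENNReal.ofReal p) volPlus := by
  have h0 : ENNReal.ofReal p ≠ 0 := by simpa using hp0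
  rw [eLpNorm_eq_lintegral_rpow_enorm_toReal h0 ENNReal.ofReal_ne_top,
    eLpNorm_eq_lintegral_rpow_enorm_toReal h0 ENNReal.ofReal_ne_top,
    ENNReal.toReal_ofReal hp0.le, ← hβ.lintegral_comp fun s => ‖f s‖ₑ ^ p]
  congr 1
  refine lintegral_congr_ae ?_
  filter_upwards [ae_pos] with t ht
  have hd := hβ.deriv_pos t ht
  have h1 : (0 : ℝ) < deriv β t ^ (1 / p) := Real.rpow_pos_of_pos hd _
  rw [weightedShift, enorm_mul, ENNReal.mul_rpow_of_nonneg _ _ hp0.le, ← ofReal_norm,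
    Complex.norm_real, Real.norm_of_nonneg h1.le, ENNReal.ofReal_rpow_of_pos h1,
    ← Real.rpow_mul hd.le, one_div, inv_mul_cancel₀ hp0.ne', Real.rpow_one]

theorem memLp_weightedShift (hβ : IsPosDiffeo β) (p : ℝ) [hp : Fact (1 < p)] (f : LpPlus p) :
    MemLp (weightedShift p β f) (ENNReal.ofReal p) volPlus :=
  ⟨hβ.aestronglyMeasurable_weightedShift p (Lp.aestronglyMeasurable f), by
    rw [hβ.eLpNorm_weightedShift (one_pos.trans hp.out)]
    exact Lp.eLpNorm_lt_top f⟩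

end IsPosDiffeo

/-! ### The inverse shift and the isometry `U_α`. -/

namespace IsSOS

variable {α : ℝ → ℝ}

theorem isPosDiffeo (hα : IsSOS α) : IsPosDiffeo α where
  bijOn := hα.bijOn
  differentiableAt _ ht := (hα.hasDerivAt ht).differentiableAt
  deriv_pos := hα.deriv_pos

theorem exists_inverse (hα : IsSOS α) : ∃ β : ℝ → ℝ, IsPosDiffeo β ∧
    (∀ t > 0, β (α t) = t) ∧ (∀ s > 0, α (β s) = s) ∧
    (∀ s > 0, deriv β s = (deriv α (β s))⁻¹) := by
  set β := Function.invFunOn α (Ioi 0) with hβ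
  have hinv : InvOn β α (Ioi 0) (Ioi 0) := hα.bijOn.invOn_invFunOn
  have hbij : BijOn β (Ioi 0) (Ioi 0) := hα.bijOn.symm hinv.symm
  have hmono : StrictMonoOn β (Ioi 0) := fun s hs t ht hst => by
    rw [← hα.strictMonoOn.lt_iff_lt (hbij.mapsTo hs) (hbij.mapsTo ht), hinv.2 hs, hinv.2 ht]
    exact hst
  have hd (s : ℝ) (hs : 0 < s) : HasDerivAt β (deriv α (β s))⁻¹ s := by
    have hs' : 0 < β s := hbij.mapsTo hs
    refine HasDerivAt.of_local_left_inverse ?_ (hα.hasDerivAt hs') (hα.deriv_pos _ hs').ne' ?_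
    -- A monotone function whose image is a neighbourhood of the value has no jump there.
    · refine hmono.continuousAt_of_image_mem_nhds (Ioi_mem_nhds hs) ?_
      rw [hbij.image_eq]
      exact Ioi_mem_nhds hs'
    · filter_upwards [Ioi_mem_nhds hs] with y hy using hinv.2 hy
  refine ⟨β, ⟨hbij, fun s hs => (hd s hs).differentiableAt, fun s hs => ?_⟩,
    fun t ht => hinv.1 ht, fun s hs => hinv.2 hs, fun s hs => (hd s hs).deriv⟩
  rw [(hd s hs).deriv]
  exact inv_pos.2 (hα.deriv_pos _ (hbij.mapsTo hs))

end IsSOS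

theorem weightedShift_comp {p : ℝ} {α β : ℝ → ℝ} {t : ℝ} (f : ℝ → ℂ) (h : β (α t) = t)
    (hα : 0 < deriv α t) (hd : deriv β (α t) = (deriv α t)⁻¹) :
    weightedShift p α (weightedShift p β f) t = f t := by
  rw [weightedShift, weightedShift, hd, h, ← mul_assoc, ← Complex.ofReal_mul,
    ← Real.mul_rpow hα.le (inv_pos.2 hα).le, mul_inv_cancel₀ hα.ne']
  simp

theorem exists_isWeightedShift (p : ℝ) [hp : Fact (1 < p)] {α : ℝ → ℝ} (hα : IsSOS α) :
    ∃ U : LpPlus p ≃ₗᵢ[ℂ] LpPlus p, IsWeightedShift p α U := by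
  obtain ⟨β, hβ, hβα, hαβ, hd⟩ := hα.exists_inverse
  have hα' := hα.isPosDiffeo
  have hp0 : 0 < p := one_pos.trans hp.out
  -- The inverse of `U_α` is the weighted shift by β = α⁻¹, the weights cancelling by the chain
  -- rule. Both composition orders follow from this one statement by exchanging the roles of α and
  -- β.
  have hleft {a b : ℝ → ℝ} (ha : IsPosDiffeo a) (hb : IsPosDiffeo b)
      (hba : ∀ t > 0, b (a t) = t) (hd : ∀ t > 0, deriv b (a t) = (deriv a t)⁻¹) (f : LpPlus p) :
      (ha.memLp_weightedShift p ((hb.memLp_weightedShift p f).toLp _)).toLp _ = f := by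
    apply Lp.ext
    filter_upwards [(ha.memLp_weightedShift p ((hb.memLp_weightedShift p f).toLp _)).coeFn_toLp,
      ha.ae_comp (hb.memLp_weightedShift p f).coeFn_toLp, ae_pos] with t h1 h2 ht
    rw [h1, ← weightedShift_comp (p := p) f (hba t ht) (ha.deriv_pos t ht) (hd t ht), weightedShift, h2]
    rfl
  refine ⟨
    { toFun := fun f => (hα'.memLp_weightedShift p f).toLp _
      invFun := fun g => (hβ.memLp_weightedShift p g).toLp _
      map_add' := fun f g => ?_
      map_smul' := fun c f => ?_
      left_inv := fun f => hleft hβ hα' hαβ (fun s hs => ?_) f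
      right_inv := fun g => hleft hα' hβ hβα (fun t ht => ?_) g
      norm_map' := fun f => ?_ }, fun f => (hα'.memLp_weightedShift p f).coeFn_toLp⟩
  · apply Lp.ext
    filter_upwards [(hα'.memLp_weightedShift p (f + g)).coeFn_toLp,
      (hα'.memLp_weightedShift p f).coeFn_toLp, (hα'.memLp_weightedShift p g).coeFn_toLp,
      Lp.coeFn_add ((hα'.memLp_weightedShift p f).toLp _)
      ((hα'.memLp_weightedShift p g).toLp _), hα'.ae_comp (Lp.coeFn_add f g)] with t h1 h2 h3 h4 h5
    rw [h1, h4, Pi.add_apply, h2, h3]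
    simp only [weightedShift]
    rw [h5, Pi.add_apply, mul_add]
  · apply Lp.ext
    filter_upwards [(hα'.memLp_weightedShift p (c • f)).coeFn_toLp,
      (hα'.memLp_weightedShift p f).coeFn_toLp,
      Lp.coeFn_smul c ((hα'.memLp_weightedShift p f).toLp _),
      hα'.ae_comp (Lp.coeFn_smul c f)] with t h1 h2 h4 h5
    rw [h1, RingHom.id_apply, h4, Pi.smul_apply, h2]
    simp only [weightedShift]
    rw [h5, Pi.smul_apply, smul_eq_mul, smul_eq_mul]
    ring
  · rw [hd s hs, inv_inv]
  · rw [hd _ (hα.pos ht), hβα t ht]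
  · change ‖(hα'.memLp_weightedShift p f).toLp _‖ = ‖f‖
    rw [Lp.norm_toLp, hα'.eLpNorm_weightedShift hp0, Lp.norm_def]

/-! ### The invariant measure -/

instance sFinite_volPlus : SFinite volPlus := by unfold volPlus; infer_instance

instance sFinite_mu : SFinite mu := by unfold mu; infer_instance

theorem ae_mu_pos : ∀ᵐ t ∂mu, (0 : ℝ) < t := mu_ac.ae_le ae_pos

/-- The substitution t = exp u; dilation invariance of `mu` is then translation invariance on ℝ. -/
theorem lintegral_mu (g : ℝ → ℝ≥0∞) : ∫⁻ t, g t ∂mu = ∫⁻ u, g (Real.exp u) := by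
  have h := lintegral_image_eq_lintegral_abs_deriv_mul MeasurableSet.univ
    (fun u _ => (Real.hasDerivAt_exp u).hasDerivWithinAt) Real.exp_injective.injOn
    (fun t => ENNReal.ofReal (1 / t) * g t)
  rw [image_univ, Real.range_exp] at h
  rw [mu, lintegral_withDensity_eq_lintegral_mul_non_measurable _ measurable_density
      (Eventually.of_forall fun _ => ENNReal.ofReal_lt_top), volPlus]
  simp only [Pi.mul_apply]
  rw [h, Measure.restrict_univ]
  refine lintegral_congr fun u => ?_
  rw [← mul_assoc, ← ENNReal.ofReal_mul (abs_nonneg _), abs_of_pos (Real.exp_pos u),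
    mul_one_div_cancel (Real.exp_pos u).ne', ENNReal.ofReal_one, one_mul]

theorem measurePreserving_exp : MeasurePreserving Real.exp volume mu := by
  refine ⟨Real.measurable_exp, Measure.ext fun s hs => ?_⟩
  rw [Measure.map_apply Real.measurable_exp hs, ← lintegral_indicator_one hs, lintegral_mu,
    ← lintegral_indicator_one (Real.measurable_exp hs)]
  rfl

theorem integrable_mu_iff {g : ℝ → ℂ} :
    Integrable g mu ↔ IntegrableOn (fun τ => g τ / (τ : ℂ)) (Ioi 0) := by
  rw [mu, integrable_withDensity_iff_integrable_smul' measurable_density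
    (Eventually.of_forall fun _ => ENNReal.ofReal_lt_top), IntegrableOn, volPlus]
  refine integrable_congr ?_
  filter_upwards [ae_pos] with τ hτ
  rw [ENNReal.toReal_ofReal (by positivity), Complex.real_smul]
  push_cast
  ring

theorem integral_mu (g : ℝ → ℂ) : ∫ τ, g τ ∂mu = ∫ τ in Ioi (0 : ℝ), g τ / (τ : ℂ) := by
  rw [mu, integral_withDensity_eq_integral_toReal_smul measurable_density
    (Eventually.of_forall fun _ => ENNReal.ofReal_lt_top), volPlus]
  refine integral_congr_ae ?_
  filter_upwards [ae_pos] with τ hτ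
  rw [ENNReal.toReal_ofReal (by positivity), Complex.real_smul]
  push_cast
  ring

/-! ### The Schur test -/

/-- The Schur test for a kernel whose two partial integrals are at most `A`. -/
theorem lintegral_rpow_lintegral_mul_le {X : Type*} [MeasurableSpace X] {ν : Measure X} [SFinite ν]
    {k : X → X → ℝ≥0∞} (hk : Measurable (Function.uncurry k)) {F : X → ℝ≥0∞} (hF : Measurable F)
    {A : ℝ≥0∞} (h1 : ∀ᵐ x ∂ν, ∫⁻ y, k x y ∂ν ≤ A) (h2 : ∀ᵐ y ∂ν, ∫⁻ x, k x y ∂ν ≤ A)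
    {p : ℝ} (hp : 1 < p) :
    ∫⁻ x, (∫⁻ y, k x y * F y ∂ν) ^ p ∂ν ≤ A ^ p * ∫⁻ y, F y ^ p ∂ν := by
  have hp0 : 0 < p := one_pos.trans hp
  have hq : 0 ≤ 1 - 1 / p := by
    rw [sub_nonneg, div_le_one hp0]
    exact hp.le
  have hpt : ∀ᵐ x ∂ν, (∫⁻ y, k x y * F y ∂ν) ^ p ≤
      A ^ (p - 1) * ∫⁻ y, k x y * F y ^ p ∂ν := by
    filter_upwards [h1] with x hx
    have hkx : Measurable (k x) := hk.of_uncurry_left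
    -- Hölder's inequality for the splitting kF = k^{1 - 1/p} (kF^p)^{1/p}; the second partial
    -- integral enters afterwards through Tonelli's theorem.
    have h := ENNReal.lintegral_mul_norm_pow_le (μ := ν) (f := k x)
      (g := fun y => k x y * F y ^ p) hkx.aemeasurable
      (hkx.mul (hF.pow_const p)).aemeasurable hq (by positivity : 0 ≤ 1 / p) (by ring)
    have he : ∀ y, k x y ^ (1 - 1 / p) * (k x y * F y ^ p) ^ (1 / p) = k x y * F y := by
      intro y
      rw [ENNReal.mul_rpow_of_nonneg _ _ (by positivity), ← mul_assoc,
        ← ENNReal.rpow_add_of_nonneg _ _ hq (by positivity), ← ENNReal.rpow_mul,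
        mul_one_div_cancel hp0.ne', sub_add_cancel, ENNReal.rpow_one, ENNReal.rpow_one]
    simp only [he] at h
    calc (∫⁻ y, k x y * F y ∂ν) ^ p
        ≤ ((∫⁻ y, k x y ∂ν) ^ (1 - 1 / p) * (∫⁻ y, k x y * F y ^ p ∂ν) ^ (1 / p)) ^ p := by
          gcongr
      _ = (∫⁻ y, k x y ∂ν) ^ (p - 1) * ∫⁻ y, k x y * F y ^ p ∂ν := by
          rw [ENNReal.mul_rpow_of_nonneg _ _ hp0.le, ← ENNReal.rpow_mul, ← ENNReal.rpow_mul,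
            one_div_mul_cancel hp0.ne', ENNReal.rpow_one, sub_mul, one_mul,
            one_div_mul_cancel hp0.ne']
      _ ≤ _ := by
          gcongr
  have hm : Measurable (Function.uncurry fun x y => k x y * F y ^ p) :=
    hk.mul ((hF.comp measurable_snd).pow_const p)
  calc ∫⁻ x, (∫⁻ y, k x y * F y ∂ν) ^ p ∂ν
      ≤ ∫⁻ x, A ^ (p - 1) * ∫⁻ y, k x y * F y ^ p ∂ν ∂ν := lintegral_mono_ae hpt
    _ = A ^ (p - 1) * ∫⁻ y, ∫⁻ x, k x y * F y ^ p ∂ν ∂ν := by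
        have hm' : Measurable fun x => ∫⁻ y, k x y * F y ^ p ∂ν := Measurable.lintegral_prod_right' hm
        rw [lintegral_const_mul _ hm',
          lintegral_lintegral_swap hm.aemeasurable]
    _ ≤ A ^ (p - 1) * ∫⁻ y, A * F y ^ p ∂ν := by
        gcongr A ^ (p - 1) * ?_
        refine lintegral_mono_ae ?_
        filter_upwards [h2] with y hy
        rw [lintegral_mul_const _ hk.of_uncurry_right]
        gcongr
    _ = A ^ p * ∫⁻ y, F y ^ p ∂ν := by
        rw [lintegral_const_mul _ (hF.pow_const p), ← mul_assoc]
        congr 1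
        nth_rewrite 2 [← ENNReal.rpow_one A]
        rw [← ENNReal.rpow_add_of_nonneg _ _ (by linarith) zero_le_one, sub_add_cancel]

/-! ### The Mellin convolution operator -/

/-- The kernel `s ^ δ / (1 + s)`. -/
noncomputable def kappa (δ : ℂ) (s : ℝ) : ℂ := (s : ℂ) ^ δ / ((1 + s : ℝ) : ℂ)

theorem measurable_kappa (δ : ℂ) : Measurable (kappa δ) := by
  unfold kappa
  fun_prop

theorem norm_kappa_of_pos (δ : ℂ) {s : ℝ} (hs : 0 < s) :
    ‖kappa δ s‖ = s ^ δ.re / (1 + s) := by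
  rw [kappa, norm_div, Complex.norm_cpow_eq_rpow_re_of_pos hs, Complex.norm_real,
    Real.norm_of_nonneg (by positivity)]

/-- The denominator 1 + e^u is at least e^u, used for u ≥ 0, and at least 1, used for u ≤ 0. Taking
c = 0 gives |κ| ≤ 1, and c = min(Re δ, 1 - Re δ) gives integrability. -/
theorem norm_kappa_exp_le {δ : ℂ} {c : ℝ} (h0 : c ≤ δ.re) (h1 : δ.re ≤ 1 - c) (u : ℝ) :
    ‖kappa δ (Real.exp u)‖ ≤ Real.exp (-(c * |u|)) := by
  rw [norm_kappa_of_pos δ (Real.exp_pos u), div_le_iff₀ (by positivity), ← Real.exp_mul, mul_add,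
    mul_one, ← Real.exp_add]
  rcases le_total 0 u with hu | hu
  · rw [abs_of_nonneg hu]
    refine le_add_of_nonneg_of_le (Real.exp_pos _).le (Real.exp_le_exp.2 ?_)
    nlinarith
  · rw [abs_of_nonpos hu]
    refine le_add_of_le_of_nonneg (Real.exp_le_exp.2 ?_) (Real.exp_pos _).le
    nlinarith

/-- The `L¹` norm of the kernel with respect to the invariant measure. -/
noncomputable def kappaMass (δ : ℂ) : ℝ≥0∞ := ∫⁻ u, ‖kappa δ (Real.exp u)‖ₑ

theorem norm_kappa_exp_le_one {δ : ℂ} (h0 : 0 < δ.re) (h1 : δ.re < 1) (u : ℝ) :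
    ‖kappa δ (Real.exp u)‖ ≤ 1 := by
  simpa using norm_kappa_exp_le (c := 0) h0.le (by linarith) u

theorem kappaMass_lt_top {δ : ℂ} (h0 : 0 < δ.re) (h1 : δ.re < 1) : kappaMass δ < ∞ := by
  set c := min δ.re (1 - δ.re) with hc
  have hc0 : 0 < c := lt_min h0 (by linarith)
  have hi : Integrable fun u : ℝ => Real.exp (-(c * |u|)) := by
    simpa [abs_mul, abs_of_pos hc0] using integrable_exp_neg_abs.comp_mul_left' hc0.ne'
  refine lt_of_le_of_lt (lintegral_mono fun u => ?_) hi.lintegral_lt_top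
  rw [← ofReal_norm]
  refine ENNReal.ofReal_le_ofReal (norm_kappa_exp_le (min_le_left _ _) ?_ u)
  linarith [min_le_right δ.re (1 - δ.re)]

theorem lintegral_kappa_left (δ : ℂ) {t : ℝ} (ht : 0 < t) :
    ∫⁻ τ, ‖kappa δ (t / τ)‖ₑ ∂mu = kappaMass δ := by
  rw [lintegral_mu, kappaMass,
    ← lintegral_sub_left_eq_self (fun u => ‖kappa δ (Real.exp u)‖ₑ) (Real.log t)]
  refine lintegral_congr fun u => ?_
  rw [Real.exp_sub, Real.exp_log ht]

theorem lintegral_kappa_right (δ : ℂ) {τ : ℝ} (hτ : 0 < τ) :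
    ∫⁻ t, ‖kappa δ (t / τ)‖ₑ ∂mu = kappaMass δ := by
  rw [lintegral_mu, kappaMass,
    ← lintegral_sub_right_eq_self (fun u => ‖kappa δ (Real.exp u)‖ₑ) (Real.log τ)]
  refine lintegral_congr fun u => ?_
  rw [Real.exp_sub, Real.exp_log hτ]

theorem norm_kappa_le_one {δ : ℂ} (h0 : 0 < δ.re) (h1 : δ.re < 1) {s : ℝ} (hs : 0 < s) :
    ‖kappa δ s‖ ≤ 1 := by
  simpa [Real.exp_log hs] using norm_kappa_exp_le_one h0 h1 (Real.log s)

theorem measurable_uncurry_kappa (δ : ℂ) : Measurable (fun z : ℝ × ℝ => kappa δ (z.1 / z.2)) :=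
  (measurable_kappa δ).comp (by fun_prop)

section

variable {p : ℝ} [hp : Fact (1 < p)] {δ : ℂ}

theorem lintegral_enorm_rpow_lt_top (f : LpMu p) : ∫⁻ t, ‖f t‖ₑ ^ p ∂mu < ∞ := by
  have hp0 : 0 < p := one_pos.trans hp.out
  have h := lintegral_rpow_enorm_lt_top_of_eLpNorm_lt_top (by simpa using hp0)
    ENNReal.ofReal_ne_top (Lp.eLpNorm_lt_top f)
  rwa [ENNReal.toReal_ofReal hp0.le] at h

/-- As |κ| ≤ 1, the product |κ f| is at most |κ| where |f| ≤ 1 and at most |f|^p elsewhere. This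
holds for every t > 0, not merely almost every t. -/
theorem integrable_kappa_mul (h0 : 0 < δ.re) (h1 : δ.re < 1) (f : LpMu p) {t : ℝ} (ht : 0 < t) :
    Integrable (fun τ => kappa δ (t / τ) * f τ) mu := by
  have hp0 : 0 < p := one_pos.trans hp.out
  have hk : Measurable fun τ : ℝ => kappa δ (t / τ) := (measurable_kappa δ).comp (by fun_prop)
  refine ⟨hk.aestronglyMeasurable.mul (Lp.aestronglyMeasurable f), ?_⟩
  have h2 : ∫⁻ τ, (‖kappa δ (t / τ)‖ₑ + ‖f τ‖ₑ ^ p) ∂mu < ∞ := by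
    rw [lintegral_add_left hk.enorm, lintegral_kappa_left δ ht]
    exact ENNReal.add_lt_top.2 ⟨kappaMass_lt_top h0 h1, lintegral_enorm_rpow_lt_top f⟩
  refine lt_of_le_of_lt (lintegral_mono_ae ?_) h2
  filter_upwards [ae_mu_pos] with τ hτ
  have hk1 : ‖kappa δ (t / τ)‖ₑ ≤ 1 := by
    rw [← ofReal_norm, ← ENNReal.ofReal_one]
    exact ENNReal.ofReal_le_ofReal (norm_kappa_le_one h0 h1 (div_pos ht hτ))
  rw [enorm_mul]
  rcases le_total ‖f τ‖ₑ 1 with hf | hf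
  · exact le_add_of_le_of_nonneg (mul_le_of_le_one_right' hf) bot_le
  · refine le_add_of_nonneg_of_le bot_le ?_
    refine (mul_le_of_le_one_left' hk1).trans ?_
    nth_rewrite 1 [← ENNReal.rpow_one ‖f τ‖ₑ]
    exact ENNReal.rpow_le_rpow_of_exponent_le hf hp.out.le

/-- The function `t ↦ ∫ κ(t / τ) f(τ) dμ(τ)`. -/
noncomputable def mellinConv (δ : ℂ) (f : ℝ → ℂ) (t : ℝ) : ℂ := ∫ τ, kappa δ (t / τ) * f τ ∂mu

theorem eLpNorm_mellinConv_le (f : LpMu p) :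
    eLpNorm (mellinConv δ f) (ENNReal.ofReal p) mu ≤
      kappaMass δ * eLpNorm f (ENNReal.ofReal p) mu := by
  have hp0 : 0 < p := one_pos.trans hp.out
  have h0 : ENNReal.ofReal p ≠ 0 := by simpa using hp0
  rw [eLpNorm_eq_lintegral_rpow_enorm_toReal h0 ENNReal.ofReal_ne_top,
    eLpNorm_eq_lintegral_rpow_enorm_toReal h0 ENNReal.ofReal_ne_top, ENNReal.toReal_ofReal hp0.le]
  have h := lintegral_rpow_lintegral_mul_le (ν := mu) (k := fun t τ => ‖kappa δ (t / τ)‖ₑ)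
    (measurable_uncurry_kappa δ).enorm (F := fun τ => ‖f τ‖ₑ)
    (Lp.stronglyMeasurable f).measurable.enorm (A := kappaMass δ)
    (by filter_upwards [ae_mu_pos] with t ht using (lintegral_kappa_left δ ht).le)
    (by filter_upwards [ae_mu_pos] with t ht using (lintegral_kappa_right δ ht).le) hp.out
  calc (∫⁻ t, ‖mellinConv δ f t‖ₑ ^ p ∂mu) ^ (1 / p)
      ≤ (kappaMass δ ^ p * ∫⁻ τ, ‖f τ‖ₑ ^ p ∂mu) ^ (1 / p) := by
        gcongr
        refine le_trans (lintegral_mono fun t => ?_) h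
        gcongr
        refine (enorm_integral_le_lintegral_enorm _).trans (le_of_eq ?_)
        simp only [enorm_mul]
    _ = _ := by
        rw [ENNReal.mul_rpow_of_nonneg _ _ (by positivity), ← ENNReal.rpow_mul,
          mul_one_div_cancel hp0.ne', ENNReal.rpow_one]

theorem memLp_mellinConv (h0 : 0 < δ.re) (h1 : δ.re < 1) (f : LpMu p) :
    MemLp (mellinConv δ f) (ENNReal.ofReal p) mu := by
  refine ⟨?_, (eLpNorm_mellinConv_le f).trans_lt
    (ENNReal.mul_lt_top (kappaMass_lt_top h0 h1) (Lp.eLpNorm_lt_top f))⟩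
  refine StronglyMeasurable.aestronglyMeasurable (StronglyMeasurable.integral_prod_right' (ν := mu)
    (f := fun z : ℝ × ℝ => kappa δ (z.1 / z.2) * f z.2) ?_)
  exact (measurable_uncurry_kappa δ).stronglyMeasurable.mul
    ((Lp.stronglyMeasurable f).comp_measurable measurable_snd)

theorem mellinConv_congr {f g : ℝ → ℂ} (h : f =ᵐ[mu] g) (t : ℝ) :
    mellinConv δ f t = mellinConv δ g t := by
  refine integral_congr_ae ?_
  filter_upwards [h] with τ hτ
  rw [hτ]

/-- The Mellin convolution operator with kernel `κ` on `L^p(ℝ₊, dμ)`. -/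
noncomputable def mellinConvOp (p : ℝ) [Fact (1 < p)] (h0 : 0 < δ.re) (h1 : δ.re < 1) :
    LpMu p →L[ℂ] LpMu p :=
  LinearMap.mkContinuous
    { toFun := fun f => (memLp_mellinConv h0 h1 f).toLp _
      map_add' := fun f g => by
        apply Lp.ext
        filter_upwards [(memLp_mellinConv h0 h1 (f + g)).coeFn_toLp,
          (memLp_mellinConv h0 h1 f).coeFn_toLp, (memLp_mellinConv h0 h1 g).coeFn_toLp,
          Lp.coeFn_add ((memLp_mellinConv h0 h1 f).toLp _) ((memLp_mellinConv h0 h1 g).toLp _),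
          ae_mu_pos] with t e1 e2 e3 e4 ht
        rw [e1, e4, Pi.add_apply, e2, e3, mellinConv_congr (Lp.coeFn_add f g), mellinConv,
          mellinConv, mellinConv, ← integral_add (integrable_kappa_mul h0 h1 f ht)
          (integrable_kappa_mul h0 h1 g ht)]
        simp only [Pi.add_apply, mul_add]
      map_smul' := fun c f => by
        apply Lp.ext
        filter_upwards [(memLp_mellinConv h0 h1 (c • f)).coeFn_toLp,
          (memLp_mellinConv h0 h1 f).coeFn_toLp,
          Lp.coeFn_smul c ((memLp_mellinConv h0 h1 f).toLp _)] with t e1 e2 e3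
        rw [e1, RingHom.id_apply, e3, Pi.smul_apply, e2, mellinConv_congr (Lp.coeFn_smul c f),
          mellinConv, mellinConv, ← integral_smul]
        simp only [Pi.smul_apply, smul_eq_mul]
        refine integral_congr_ae (Eventually.of_forall fun τ => ?_)
        ring }
    (kappaMass δ).toReal fun f => by
      change ‖(memLp_mellinConv h0 h1 f).toLp _‖ ≤ _
      rw [Lp.norm_toLp, Lp.norm_def, ← ENNReal.toReal_mul]
      exact ENNReal.toReal_mono (ENNReal.mul_ne_top (kappaMass_lt_top h0 h1).ne
        (Lp.eLpNorm_ne_top f)) (eLpNorm_mellinConv_le f)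

theorem coeFn_mellinConvOp (h0 : 0 < δ.re) (h1 : δ.re < 1) (f : LpMu p) :
    mellinConvOp p h0 h1 f =ᵐ[mu] mellinConv δ f :=
  (memLp_mellinConv h0 h1 f).coeFn_toLp

end

/-! ### The operator `R_γ` -/

theorem coeFn_Phi (p : ℝ) [Fact (1 < p)] (f : LpPlus p) : Phi p f =ᵐ[mu] phiFun p f :=
  (memLp_phiFun p f).coeFn_toLp

theorem coeFn_Phi_symm (p : ℝ) [Fact (1 < p)] (f : LpMu p) :
    (Phi p).symm f =ᵐ[volPlus] phiInvFun p f :=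
  (memLp_phiInvFun p f).coeFn_toLp

/-- Shows that conjugation by Φ makes `R_γ` a convolution on the multiplicative group: moving
(t/τ)^{1/p} into the kernel changes the exponent γ to δ, and τ + t = τ(1 + t/τ) releases the density
1/τ of `mu`. -/
theorem rIntegrand_eq {p : ℝ} {γ δ : ℂ} (hδ : δ = ((1 / p : ℝ) : ℂ) + γ) (f : ℝ → ℂ) {t τ : ℝ}
    (ht : 0 < t) (hτ : 0 < τ) :
    rIntegrand γ f t τ =
      ((t ^ (-(1 / p)) : ℝ) : ℂ) * (kappa δ (t / τ) * phiFun p f τ / (τ : ℂ)) := by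
  have hs : 0 < t / τ := div_pos ht hτ
  have h1 : ((t / τ : ℝ) : ℂ) ^ δ = ((t ^ (1 / p) * (τ ^ (1 / p))⁻¹ : ℝ) : ℂ) *
      ((t / τ : ℝ) : ℂ) ^ γ := by
    rw [hδ, Complex.cpow_add _ _ (Complex.ofReal_ne_zero.2 hs.ne'), ← Complex.ofReal_cpow hs.le,
      Real.div_rpow ht.le hτ.le, div_eq_mul_inv]
  have h2 : ((1 + t / τ : ℝ) : ℂ) = ((τ + t : ℝ) : ℂ) / (τ : ℂ) := by
    have : (τ : ℂ) ≠ 0 := Complex.ofReal_ne_zero.2 hτ.ne'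
    push_cast
    field_simp
  have h3 : ((t ^ (1 / p) : ℝ) : ℂ) ≠ 0 :=
    Complex.ofReal_ne_zero.2 (Real.rpow_pos_of_pos ht _).ne'
  have h4 : ((τ ^ (1 / p) : ℝ) : ℂ) ≠ 0 :=
    Complex.ofReal_ne_zero.2 (Real.rpow_pos_of_pos hτ _).ne'
  have h5 : (τ : ℂ) ≠ 0 := Complex.ofReal_ne_zero.2 hτ.ne'
  have h6 : ((τ + t : ℝ) : ℂ) ≠ 0 := Complex.ofReal_ne_zero.2 (by positivity)
  rw [rIntegrand, kappa, phiFun, h1, h2, Real.rpow_neg ht.le, Complex.ofReal_mul,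
    Complex.ofReal_inv, Complex.ofReal_inv]
  generalize ((t / τ : ℝ) : ℂ) ^ γ = z
  generalize ((t ^ (1 / p) : ℝ) : ℂ) = a at *
  generalize ((τ ^ (1 / p) : ℝ) : ℂ) = b at *
  generalize ((τ + t : ℝ) : ℂ) = c at *
  field_simp

/-- The operator `R_γ`. -/
noncomputable def rOp (p : ℝ) [Fact (1 < p)] {δ : ℂ} (h0 : 0 < δ.re) (h1 : δ.re < 1) :
    LpPlus p →L[ℂ] LpPlus p :=
  ((Phi p).symm.toContinuousLinearEquiv : LpMu p →L[ℂ] LpPlus p) ∘L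
    ((1 / (Real.pi * Complex.I) : ℂ) • mellinConvOp p h0 h1) ∘L
      ((Phi p).toContinuousLinearEquiv : LpPlus p →L[ℂ] LpMu p)

theorem rOp_apply (p : ℝ) [Fact (1 < p)] {δ : ℂ} (h0 : 0 < δ.re) (h1 : δ.re < 1) (f : LpPlus p) :
    rOp p h0 h1 f =
      (Phi p).symm ((1 / (Real.pi * Complex.I) : ℂ) • mellinConvOp p h0 h1 (Phi p f)) := rfl

theorem coeFn_rOp (p : ℝ) [Fact (1 < p)] {δ : ℂ} (h0 : 0 < δ.re) (h1 : δ.re < 1) (f : LpPlus p) :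
    rOp p h0 h1 f =ᵐ[volPlus] fun t => ((t ^ (-(1 / p)) : ℝ) : ℂ) *
      (1 / (Real.pi * Complex.I) * mellinConv δ (Phi p f) t) := by
  rw [rOp_apply]
  filter_upwards [coeFn_Phi_symm p ((1 / (Real.pi * Complex.I) : ℂ) •
    mellinConvOp p h0 h1 (Phi p f)), ac_mu.ae_le (Lp.coeFn_smul (1 / (Real.pi * Complex.I) : ℂ)
    (mellinConvOp p h0 h1 (Phi p f))), ac_mu.ae_le (coeFn_mellinConvOp h0 h1 (Phi p f))]
    with t e1 e2 e3
  rw [e1, phiInvFun, e2, Pi.smul_apply, e3, smul_eq_mul]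

theorem isROperator_rOp (p : ℝ) [Fact (1 < p)] {γ δ : ℂ} (hδ : δ = ((1 / p : ℝ) : ℂ) + γ)
    (h0 : 0 < δ.re) (h1 : δ.re < 1) : IsROperator p γ (rOp p h0 h1) := by
  intro f
  have hae (t : ℝ) (ht : 0 < t) : rIntegrand γ f t =ᵐ[volPlus] fun τ =>
      ((t ^ (-(1 / p)) : ℝ) : ℂ) * (kappa δ (t / τ) * Phi p f τ / (τ : ℂ)) := by
    filter_upwards [ae_pos, ac_mu.ae_le (coeFn_Phi p f)] with τ hτ h
    rw [rIntegrand_eq hδ f ht hτ, h]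
  refine ⟨fun t ht => ?_, ?_⟩
  · refine Integrable.congr (Integrable.const_mul ?_ _) (hae t ht).symm
    exact integrable_mu_iff.1 (integrable_kappa_mul h0 h1 (Phi p f) ht)
  · filter_upwards [coeFn_rOp p h0 h1 f, ae_pos] with t e ht
    have hi : ∫ τ in Ioi (0 : ℝ), rIntegrand γ f t τ = ∫ τ in Ioi (0 : ℝ),
        ((t ^ (-(1 / p)) : ℝ) : ℂ) * (kappa δ (t / τ) * Phi p f τ / (τ : ℂ)) :=
      integral_congr_ae (hae t ht)
    rw [integral_const_mul] at hi
    rw [e, mellinConv, integral_mu, hi]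
    ring

/-! ### The Mellin transform of `1 / (1 + t)` -/

theorem ofReal_cpow_eq_exp {x : ℝ} (hx : 0 < x) (z : ℂ) :
    (x : ℂ) ^ z = Complex.exp (Real.log x * z) := by
  rw [Complex.cpow_def_of_ne_zero (Complex.ofReal_ne_zero.2 hx.ne'), Complex.ofReal_log hx.le]

theorem image_div_one_add : (fun t : ℝ => t / (1 + t)) '' Ioi 0 = Ioo 0 1 := by
  ext x
  constructor
  · rintro ⟨t, ht, rfl⟩
    have ht0 : 0 < t := ht
    exact ⟨by positivity, (div_lt_one (by positivity)).2 (by linarith)⟩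
  · rintro ⟨h0, h1⟩
    have h2 : 0 < 1 - x := by linarith
    refine ⟨x / (1 - x), div_pos h0 h2, ?_⟩
    field_simp
    ring

theorem mellinConvergent_one_div_one_add {s : ℂ} (h0 : 0 < s.re) (h1 : s.re < 1) :
    MellinConvergent (fun t : ℝ => 1 / ((1 + t : ℝ) : ℂ)) s := by
  have hi : Integrable (kappa s) mu := by
    refine ⟨(measurable_kappa s).aestronglyMeasurable, ?_⟩
    rw [HasFiniteIntegral, lintegral_mu]
    exact kappaMass_lt_top h0 h1
  refine (integrable_mu_iff.1 hi).congr_fun (fun t ht => ?_) measurableSet_Ioi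
  have ht' : (t : ℂ) ≠ 0 := Complex.ofReal_ne_zero.2 (ne_of_gt ht)
  simp only [kappa]
  rw [Complex.cpow_sub _ _ ht', Complex.cpow_one, smul_eq_mul]
  ring

/-- The substitution x = t/(1 + t) carries the Mellin integral to B(s, 1 - s) = Γ(s)Γ(1 - s), and
Euler's reflection formula evaluates it. -/
theorem mellin_one_div_one_add {s : ℂ} (h0 : 0 < s.re) (h1 : s.re < 1) :
    mellin (fun t : ℝ => 1 / ((1 + t : ℝ) : ℂ)) s = Real.pi / Complex.sin (Real.pi * s) := by
  have hb := Complex.betaIntegral_eq_Gamma_mul_div s (1 - s) h0 (by simpa using h1)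
  rw [add_sub_cancel, Complex.Gamma_one, div_one, Complex.Gamma_mul_Gamma_one_sub] at hb
  rw [← hb, Complex.betaIntegral, intervalIntegral.integral_of_le zero_le_one,
    integral_Ioc_eq_integral_Ioo, ← image_div_one_add]
  have hd (t : ℝ) (ht : t ∈ Ioi (0 : ℝ)) :
      HasDerivWithinAt (fun t : ℝ => t / (1 + t)) (1 / (1 + t) ^ 2) (Ioi 0) t := by
    have ht0 : 0 < t := ht
    have h := (hasDerivAt_id' t).fun_div ((hasDerivAt_id' t).const_add 1)
      (by positivity : 1 + t ≠ 0)
    refine (h.congr_deriv ?_).hasDerivWithinAt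
    ring
  have hinj : InjOn (fun t : ℝ => t / (1 + t)) (Ioi 0) := by
    intro a ha b hb hab
    have ha0 : 0 < a := ha
    have hb0 : 0 < b := hb
    have h := (div_eq_div_iff (by positivity) (by positivity)).1 hab
    linarith
  rw [integral_image_eq_integral_abs_deriv_smul measurableSet_Ioi hd hinj, mellin]
  refine setIntegral_congr_fun measurableSet_Ioi fun t ht => ?_
  have ht0 : 0 < t := ht
  have ht1 : 0 < 1 + t := by positivity
  have e1 : (1 : ℂ) - ((t / (1 + t) : ℝ) : ℂ) = ((1 / (1 + t) : ℝ) : ℂ) := by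
    rw [← Complex.ofReal_one, ← Complex.ofReal_sub]
    congr 1
    field_simp
    ring
  have e2 : ((1 + t : ℝ) : ℂ) = Complex.exp (Real.log (1 + t)) := by
    rw [← Complex.ofReal_exp, Real.exp_log ht1]
  rw [e1, ofReal_cpow_eq_exp ht0, ofReal_cpow_eq_exp (by positivity),
    ofReal_cpow_eq_exp (by positivity), Real.log_div ht0.ne' ht1.ne', one_div (1 + t), Real.log_inv,
    abs_of_pos (by positivity), smul_eq_mul, Complex.real_smul]
  have e3 : ((1 / (1 + t) ^ 2 : ℝ) : ℂ) = Complex.exp (-(2 * Real.log (1 + t))) := by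
    rw [Complex.exp_neg, two_mul, Complex.exp_add, ← e2]
    push_cast
    ring
  rw [e3, e2, one_div, ← Complex.exp_neg, ← Complex.exp_add, ← Complex.exp_add, ← Complex.exp_add]
  congr 1
  push_cast
  ring

/-! ### The inverse Mellin transform of `r_γ` -/

theorem IsRapidSymbol.integrable {r r₁ r₂ : ℝ → ℂ} {K : ℝ} (hr : IsRapidSymbol r r₁ r₂ K) :
    Integrable r := by
  have hc : Continuous r := continuous_iff_continuousAt.2 fun x => (hr.hasDerivAt x).continuousAt
  refine (integrable_exp_neg_abs.const_mul K).mono' hc.aestronglyMeasurable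
    (Eventually.of_forall fun x => (hr.bound x).trans ?_)
  have := hr.nonneg
  gcongr
  linarith [abs_nonneg x]

theorem pi_div_sin_eq {p : ℝ} {γ δ : ℂ} (hδ : δ = ((1 / p : ℝ) : ℂ) + γ) (x : ℝ) :
    Real.pi / Complex.sin (Real.pi * (δ - Complex.I * x)) =
      Real.pi * Complex.I * rSymbol p γ x := by
  have h : (Real.pi * (x + Complex.I / p + Complex.I * γ) : ℂ) =
      (Real.pi * (δ - Complex.I * x)) * Complex.I := by
    rw [hδ]
    push_cast
    linear_combination ((Real.pi : ℂ) * x) * Complex.I_mul_I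
  rw [rSymbol, h, Complex.sinh_mul_I, mul_one_div, mul_div_mul_right _ _ Complex.I_ne_zero]

/-- Mellin inversion for 1/(1 + t) on the line Re = Re δ. Written as δ - ix, that is with y = Im δ -
x, the points of the line carry the transform πi r_γ(x); multiplication by s^δ then gives κ. -/
theorem integral_cpow_mul_rSymbol {p : ℝ} {γ δ : ℂ} (hδ : δ = ((1 / p : ℝ) : ℂ) + γ)
    (h0 : 0 < δ.re) (h1 : δ.re < 1) (hr : Integrable (rSymbol p γ)) {s : ℝ} (hs : 0 < s) :
    1 / (2 * Real.pi) * ∫ x : ℝ, (s : ℂ) ^ (Complex.I * x) * rSymbol p γ x =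
      1 / (Real.pi * Complex.I) * kappa δ s := by
  set f : ℝ → ℂ := fun t => 1 / ((1 + t : ℝ) : ℂ) with hf
  have hδy (y : ℝ) : ((δ.re : ℂ) + y * Complex.I) = δ - Complex.I * (δ.im - y : ℝ) := by
    nth_rewrite 2 [← Complex.re_add_im δ]
    push_cast
    ring
  have hF (y : ℝ) : mellin f (δ.re + y * Complex.I) =
      Real.pi * Complex.I * rSymbol p γ (δ.im - y) := by
    rw [hf, mellin_one_div_one_add (by simpa using h0) (by simpa using h1), hδy, pi_div_sin_eq hδ]
  have hv : Complex.VerticalIntegrable (mellin f) δ.re := by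
    unfold Complex.VerticalIntegrable
    simp only [hF]
    exact (hr.comp_sub_left δ.im).const_mul _
  have hc : ContinuousAt f s := by
    refine ContinuousAt.div continuousAt_const (by fun_prop) ?_
    exact Complex.ofReal_ne_zero.2 (by positivity)
  have h := mellinInv_mellin_eq δ.re f hs
    (mellinConvergent_one_div_one_add (by simpa using h0) (by simpa using h1)) hv hc
  have hs' : (s : ℂ) ≠ 0 := Complex.ofReal_ne_zero.2 hs.ne'
  have hI : (∫ y : ℝ, (s : ℂ) ^ (-((δ.re : ℂ) + y * Complex.I)) •
      mellin f (δ.re + y * Complex.I)) = (s : ℂ) ^ (-δ) * (Real.pi * Complex.I) *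
        ∫ x : ℝ, (s : ℂ) ^ (Complex.I * x) * rSymbol p γ x := by
    rw [← integral_const_mul, ← integral_sub_left_eq_self _ volume δ.im]
    refine integral_congr_ae (Eventually.of_forall fun y => ?_)
    simp only
    rw [hF, hδy, neg_sub, sub_eq_add_neg, Complex.cpow_add _ _ hs', smul_eq_mul]
    ring_nf
  rw [mellinInv, hI, Complex.real_smul] at h
  change _ = 1 / ((1 + s : ℝ) : ℂ) at h
  have hsd : (s : ℂ) ^ δ * (s : ℂ) ^ (-δ) = 1 := by
    rw [← Complex.cpow_add _ _ hs']; simp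
  have hπ : (Real.pi : ℂ) ≠ 0 := Complex.ofReal_ne_zero.2 Real.pi_ne_zero
  have hI0 := Complex.I_ne_zero
  rw [kappa, div_eq_mul_one_div ((s : ℂ) ^ δ), ← h]
  generalize (s : ℂ) ^ (-δ) = a at *
  generalize (s : ℂ) ^ δ = b at *
  generalize (∫ x : ℝ, (s : ℂ) ^ (Complex.I * x) * rSymbol p γ x) = J at *
  have hJ : 1 / (Real.pi * Complex.I) * (b * (((1 / (2 * Real.pi) : ℝ) : ℂ) *
      (a * (Real.pi * Complex.I) * J))) = b * a * (1 / (2 * Real.pi) * J) := by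
    push_cast
    field_simp
  rw [hJ, hsd, one_mul]

/-! ### Density of test functions -/

/-- The transplantation of a function on `ℝ` to `ℝ₊` by the logarithm. -/
noncomputable def compLog (h : ℝ → ℂ) (t : ℝ) : ℂ := (Ioi 0).indicator (fun t => h (Real.log t)) t

theorem compLog_exp (h : ℝ → ℂ) (u : ℝ) : compLog h (Real.exp u) = h u := by
  simp [compLog, Real.exp_pos]

theorem tsupport_compLog_subset {h : ℝ → ℂ} (hc : HasCompactSupport h) :
    tsupport (compLog h) ⊆ Real.exp '' tsupport h := by
  refine closure_minimal (fun t ht => ?_) (hc.isCompact.image Real.continuous_exp).isClosed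
  have ht0 : 0 < t := by
    by_contra h0
    exact ht (indicator_of_notMem h0 _)
  refine ⟨Real.log t, subset_tsupport h ?_, Real.exp_log ht0⟩
  rwa [Function.mem_support, ← compLog_exp h, Real.exp_log ht0]

theorem isTestFunction_compLog {h : ℝ → ℂ} (hc : HasCompactSupport h)
    (hs : ContDiff ℝ (⊤ : ℕ∞) h) : IsTestFunction (compLog h) := by
  have hsub := tsupport_compLog_subset hc
  have hpos : tsupport (compLog h) ⊆ Ioi 0 := by
    intro t ht
    obtain ⟨u, _, rfl⟩ := hsub ht
    exact Real.exp_pos u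
  refine ⟨contDiff_iff_contDiffAt.2 fun t => ?_,
    (hc.isCompact.image Real.continuous_exp).of_isClosed_subset (isClosed_tsupport _) hsub, hpos⟩
  by_cases ht : t ∈ Ioi (0 : ℝ)
  · have h1 : ContDiffAt ℝ (⊤ : ℕ∞) (fun t => h (Real.log t)) t :=
      hs.contDiffAt.comp t (Real.contDiffAt_log.2 (ne_of_gt ht))
    refine h1.congr_of_eventuallyEq ?_
    filter_upwards [Ioi_mem_nhds ht] with τ hτ
    exact indicator_of_mem hτ _
  -- The support lies in the compact image under exp, away from t ≤ 0, so the function vanishes near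
  -- t.
  · have h1 := notMem_tsupport_iff_eventuallyEq.1 fun h => ht (hpos h)
    exact contDiffAt_const.congr_of_eventuallyEq h1

/-- Composition with exp is isometric into `L^p` of the line, where smooth compactly supported
functions are dense; the approximant is carried back by the logarithm. -/
theorem dense_testFunctions (p : ℝ) [hp : Fact (1 < p)] :
    Dense {F : LpMu p | ∃ (f : ℝ → ℂ) (hf : IsTestFunction f), F = (hf.memLp _).toLp f} := by
  intro g
  refine (mem_closure_iff_nhds_basis Metric.nhds_basis_closedBall).2 fun ε hε => ?_
  have hg : MemLp (g ∘ Real.exp) (ENNReal.ofReal p) volume :=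
    (Lp.memLp g).comp_measurePreserving measurePreserving_exp
  obtain ⟨h, hc, hs, hh⟩ := hg.exist_eLpNorm_sub_le ENNReal.ofReal_ne_top Fact.out hε
  have hf := isTestFunction_compLog hc hs
  have hm := hf.memLp (ENNReal.ofReal p)
  refine ⟨hm.toLp _, ⟨_, hf, rfl⟩, ?_⟩
  have h1 : eLpNorm (⇑g - compLog h) (ENNReal.ofReal p) mu ≤ ENNReal.ofReal ε := by
    rw [← eLpNorm_comp_measurePreserving ((Lp.aestronglyMeasurable g).sub hm.1)
      measurePreserving_exp]
    refine le_of_eq_of_le (congrArg (fun k => eLpNorm k _ _) (funext fun u => ?_)) hh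
    simp [compLog_exp]
  rw [Metric.mem_closedBall, dist_comm, Lp.dist_def]
  refine ENNReal.toReal_le_of_le_ofReal hε.le (le_of_eq_of_le (eLpNorm_congr_ae ?_) h1)
  filter_upwards [hm.coeFn_toLp] with t ht
  simp [ht]

theorem IsMellinPDO.unique {p : ℝ} [Fact (1 < p)] {a : ℝ → ℝ → ℂ} {A A' : LpMu p →L[ℂ] LpMu p}
    (hA : IsMellinPDO p a A) (hA' : IsMellinPDO p a A') : A' = A := by
  refine DFunLike.coe_injective (Continuous.ext_on (dense_testFunctions p) A'.continuous
    A.continuous ?_)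
  rintro _ ⟨f, hf, rfl⟩
  exact Lp.ext ((hA' f hf).2.2.trans (hA f hf).2.2.symm)

/-! ### The pseudodifferential operator -/

theorem IsTestFunction.integrableOn_div {f : ℝ → ℂ} (hf : IsTestFunction f) :
    IntegrableOn (fun τ => f τ / (τ : ℂ)) (Ioi 0) :=
  integrable_mu_iff.1 (memLp_one_iff_integrable.1 (hf.memLp 1))

theorem norm_cpow_I_mul {s : ℝ} (hs : 0 < s) (x : ℝ) : ‖(s : ℂ) ^ (Complex.I * x)‖ = 1 := by
  rw [Complex.norm_cpow_eq_rpow_re_of_pos hs]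
  simp

/-- The power has modulus 1, so the double integral is dominated by a product of integrable
functions. This licenses Fubini's theorem in the iterated integral defining the operator. -/
theorem integrable_cpow_mul {f : ℝ → ℂ} (hf : IsTestFunction f) {r : ℝ → ℂ}
    (hr : Integrable r) {s : ℝ} (hs : 0 < s) :
    Integrable (fun z : ℝ × ℝ => ((s / z.2 : ℝ) : ℂ) ^ (Complex.I * z.1) *
      (r z.1 * (f z.2 / (z.2 : ℂ)))) (volume.prod volPlus) := by
  have hi : Integrable (fun z : ℝ × ℝ => r z.1 * (f z.2 / (z.2 : ℂ))) (volume.prod volPlus) :=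
    hr.mul_prod hf.integrableOn_div
  refine hi.bdd_mul (c := 1) ?_ ?_
  · have : Measurable fun z : ℝ × ℝ => ((s / z.2 : ℝ) : ℂ) ^ (Complex.I * (z.1 : ℂ)) := by
      fun_prop
    exact this.aestronglyMeasurable
  · filter_upwards [Measure.quasiMeasurePreserving_snd.ae ae_pos] with z hz
    exact (norm_cpow_I_mul (div_pos hs hz) z.1).le

/-- The factor e^{iω(t)x} moves the evaluation point of the power from t to α(t); what remains is
the integrand for the symbol r_γ, times a weight in t. -/
theorem opIntegrand_cSymbol {p : ℝ} {γ : ℂ} {α : ℝ → ℝ} (hα : IsSOS α) (f : ℝ → ℂ) {t τ : ℝ}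
    (ht : 0 < t) (hτ : 0 < τ) (x : ℝ) :
    opIntegrand (cSymbol p γ (shiftExponent α)) f t x τ =
      (((1 + t * deriv (shiftExponent α) t) ^ (1 / p) : ℝ) : ℂ) *
        (((α t / τ : ℝ) : ℂ) ^ (Complex.I * x) * (rSymbol p γ x * (f τ / (τ : ℂ)))) := by
  have h0 := hα.pos ht
  have h1 : ((α t / τ : ℝ) : ℂ) ^ (Complex.I * x) =
      Complex.exp (Complex.I * shiftExponent α t * x) *
        ((t / τ : ℝ) : ℂ) ^ (Complex.I * x) := by
    rw [ofReal_cpow_eq_exp (div_pos h0 hτ), ofReal_cpow_eq_exp (div_pos ht hτ), ← Complex.exp_add,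
      shiftExponent, Real.log_div h0.ne' hτ.ne', Real.log_div ht.ne' hτ.ne',
      Real.log_div h0.ne' ht.ne']
    congr 1
    push_cast
    ring
  rw [opIntegrand, cSymbol, h1]
  ring

/-- The left side collects the weights of Φ and `U_α` at t and of Φ⁻¹ at α(t). -/
theorem weight_identity {p : ℝ} {α : ℝ → ℝ} (hα : IsSOS α) {t : ℝ} (ht : 0 < t) :
    t ^ (1 / p) * (deriv α t ^ (1 / p) * α t ^ (-(1 / p))) =
      (1 + t * deriv (shiftExponent α) t) ^ (1 / p) := by
  have h0 := hα.pos ht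
  have h1 := hα.deriv_pos t ht
  rw [hα.one_add_mul_deriv_shiftExponent ht, Real.rpow_neg h0.le,
    Real.div_rpow h1.le (div_pos h0 ht).le, Real.div_rpow h0.le ht.le]
  have h2 := (Real.rpow_pos_of_pos h0 (1 / p)).ne'
  have h3 := (Real.rpow_pos_of_pos ht (1 / p)).ne'
  field_simp

/-- The heart of the identity: the conjugated operator sends f to a weight times the convolution of
κ/(πi) with f evaluated at α(t). Inserting the integral representation of κ and exchanging the
integrals yields the iterated integral with symbol `cSymbol`. -/
theorem isMellinPDO_conj {p : ℝ} [hp : Fact (1 < p)] {γ δ : ℂ}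
    (hδ : δ = ((1 / p : ℝ) : ℂ) + γ) (h0 : 0 < δ.re) (h1 : δ.re < 1)
    (hr : Integrable (rSymbol p γ)) {α : ℝ → ℝ} (hα : IsSOS α)
    {U : LpPlus p ≃ₗᵢ[ℂ] LpPlus p} (hU : IsWeightedShift p α U)
    {A : LpMu p →L[ℂ] LpMu p} (hA : ∀ g, A g = Phi p (U (rOp p h0 h1 ((Phi p).symm g)))) :
    IsMellinPDO p (cSymbol p γ (shiftExponent α)) A := by
  intro f hf
  set ψ : ℝ → ℂ := fun t => (((1 + t * deriv (shiftExponent α) t) ^ (1 / p) : ℝ) : ℂ) with hψ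
  have hinner (t : ℝ) (ht : 0 < t) (x : ℝ) :
      ∫ τ in Ioi (0 : ℝ), opIntegrand (cSymbol p γ (shiftExponent α)) f t x τ =
        ψ t * ∫ τ, ((α t / τ : ℝ) : ℂ) ^ (Complex.I * x) *
          (rSymbol p γ x * (f τ / (τ : ℂ))) ∂volPlus := by
    rw [← integral_const_mul, volPlus]
    exact setIntegral_congr_fun measurableSet_Ioi fun τ hτ => opIntegrand_cSymbol hα f ht hτ x
  refine ⟨fun t ht x => ?_, fun t ht => ?_, ?_⟩
  · have hi : IntegrableOn (fun τ => ψ t * (((α t / τ : ℝ) : ℂ) ^ (Complex.I * x) *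
        (rSymbol p γ x * (f τ / (τ : ℂ))))) (Ioi 0) := by
      refine Integrable.const_mul (Integrable.bdd_mul (c := 1)
        (hf.integrableOn_div.const_mul (rSymbol p γ x)) ?_ ?_) _
      · have : Measurable fun τ : ℝ => ((α t / τ : ℝ) : ℂ) ^ (Complex.I * (x : ℂ)) := by fun_prop
        exact this.aestronglyMeasurable
      · filter_upwards [ae_pos] with τ hτ
        exact (norm_cpow_I_mul (div_pos (hα.pos ht) hτ) x).le
    exact hi.congr_fun (fun τ hτ => (opIntegrand_cSymbol hα f ht hτ x).symm) measurableSet_Ioi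
  · simp only [hinner t ht]
    exact (integrable_cpow_mul hf hr (hα.pos ht)).integral_prod_left.const_mul _
  · set g := (hf.memLp (ENNReal.ofReal p)).toLp f with hg
    have hgf : g =ᵐ[mu] f := (hf.memLp _).coeFn_toLp
    rw [hA]
    filter_upwards [coeFn_Phi p (U (rOp p h0 h1 ((Phi p).symm g))),
      mu_ac.ae_le (hU (rOp p h0 h1 ((Phi p).symm g))),
      mu_ac.ae_le (hα.isPosDiffeo.ae_comp (coeFn_rOp p h0 h1 ((Phi p).symm g))), ae_mu_pos]
      with t e1 e2 e3 ht
    have hαt := hα.pos ht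
    have hswap : ∫ x : ℝ, ∫ τ, ((α t / τ : ℝ) : ℂ) ^ (Complex.I * x) *
          (rSymbol p γ x * (f τ / (τ : ℂ))) ∂volPlus =
        ∫ τ, (∫ x : ℝ, ((α t / τ : ℝ) : ℂ) ^ (Complex.I * x) * rSymbol p γ x) *
          (f τ / (τ : ℂ)) ∂volPlus := by
      rw [integral_integral_swap (integrable_cpow_mul hf hr hαt)]
      refine integral_congr_ae (Eventually.of_forall fun τ => ?_)
      simp only [← mul_assoc]
      rw [← integral_mul_const]
    have hconv : 1 / (2 * (Real.pi : ℂ)) * ∫ x : ℝ, ∫ τ, ((α t / τ : ℝ) : ℂ) ^ (Complex.I * x) *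
          (rSymbol p γ x * (f τ / (τ : ℂ))) ∂volPlus =
        1 / (Real.pi * Complex.I) * mellinConv δ f (α t) := by
      rw [hswap, mellinConv, integral_mu, ← integral_const_mul, ← integral_const_mul, volPlus]
      refine setIntegral_congr_fun measurableSet_Ioi fun τ hτ => ?_
      rw [← mul_assoc, integral_cpow_mul_rSymbol hδ h0 h1 hr (div_pos hαt hτ)]
      ring
    simp only [hinner t ht]
    rw [e1, phiFun, e2, weightedShift, e3, LinearIsometryEquiv.apply_symm_apply,
      mellinConv_congr hgf, integral_const_mul, mul_left_comm (1 / (2 * (Real.pi : ℂ))), hconv, hψ]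
    simp only
    rw [← weight_identity hα ht]
    push_cast
    ring

end MellinShift

/-! ### Assembly of the operators. -/

theorem lemma4p4 (p : ℝ) [Fact (1 < p)] (γ : ℂ)
    (hγ0 : 0 < 1 / p + γ.re) (hγ1 : 1 / p + γ.re < 1)
    (α : ℝ → ℝ) (hα : MellinShift.IsSOS α) :
    MellinShift.MemETilde (MellinShift.cSymbol p γ (MellinShift.shiftExponent α)) ∧
    ∃ (U : MellinShift.LpPlus p ≃ₗᵢ[ℂ] MellinShift.LpPlus p)
      (R : MellinShift.LpPlus p →L[ℂ] MellinShift.LpPlus p)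
      (A : MellinShift.LpMu p →L[ℂ] MellinShift.LpMu p),
      MellinShift.IsWeightedShift p α U ∧
      MellinShift.IsROperator p γ R ∧
      MellinShift.IsMellinPDO p (MellinShift.cSymbol p γ (MellinShift.shiftExponent α)) A ∧
      (∀ A' : MellinShift.LpMu p →L[ℂ] MellinShift.LpMu p,
        MellinShift.IsMellinPDO p (MellinShift.cSymbol p γ (MellinShift.shiftExponent α)) A' →
          A' = A) ∧
      ∀ f : MellinShift.LpPlus p,
        U (R f) = (MellinShift.Phi p).symm (A (MellinShift.Phi p f)) := by
  have hδ0 : 0 < (((1 / p : ℝ) : ℂ) + γ).re := by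
    rwa [Complex.add_re, Complex.ofReal_re]
  have hδ1 : (((1 / p : ℝ) : ℂ) + γ).re < 1 := by
    rwa [Complex.add_re, Complex.ofReal_re]
  obtain ⟨r₁, r₂, K, hr⟩ := MellinShift.exists_isRapidSymbol_rSymbol hγ0 hγ1
  obtain ⟨U, hU⟩ := MellinShift.exists_isWeightedShift p hα
  set R := MellinShift.rOp p hδ0 hδ1 with hR
  -- `A` is defined as the conjugate of `U_α R_γ`, so boundedness and the final identity are
  -- immediate; the substance is `hA`, that this conjugate is given by the symbol.
  set A : MellinShift.LpMu p →L[ℂ] MellinShift.LpMu p :=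
    ((MellinShift.Phi p).toContinuousLinearEquiv :
        MellinShift.LpPlus p →L[ℂ] MellinShift.LpMu p) ∘L
      (U.toContinuousLinearEquiv : MellinShift.LpPlus p →L[ℂ] MellinShift.LpPlus p) ∘L R ∘L
      ((MellinShift.Phi p).symm.toContinuousLinearEquiv :
        MellinShift.LpMu p →L[ℂ] MellinShift.LpPlus p)
  have hA : MellinShift.IsMellinPDO p
      (MellinShift.cSymbol p γ (MellinShift.shiftExponent α)) A :=
    MellinShift.isMellinPDO_conj rfl hδ0 hδ1 hr.integrable hα hU fun _ => rfl
  refine ⟨MellinShift.memETilde_cSymbol Fact.out hγ0 hγ1 hα, U, R, A, hU,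
    MellinShift.isROperator_rOp p rfl hδ0 hδ1, hA, fun A' hA' => hA.unique hA', fun f => ?_⟩
  have h : A (MellinShift.Phi p f) =
      MellinShift.Phi p (U (R ((MellinShift.Phi p).symm (MellinShift.Phi p f)))) := rfl
  rw [h, LinearIsometryEquiv.symm_apply_apply, LinearIsometryEquiv.symm_apply_apply]
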